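/- Let $p>1$ be an integer. A configuration is a map $x:\mathbb Z\to\mathbb Z$, $i\mapsto x_i$. For $n\ge 1$ let $\mathrm{SM}(n)$ be the set of configurations such that $x_i=x_1$ for all $i<1$, $x_n\neq 0$, $x_i=0$ for all $i>n$, and $0\le x_i-x_{i+1}<p$ for all $i\in\mathbb Z$ (so $x$ is monotone and stable). In the one-dimensional Kadanoff sandpile model with parameter $p$, a site $i$ with $x_i-x_{i+1}\ge p$ may topple: then $x_i$ decreases by $p-1$ and each of $x_{i+1},\dots,x_{i+p-1}$ increases by $1$. The avalanche problem $\mathrm{AP}$ is the following decision problem: given $x\in \mathrm{SM}(n)$ and $k$ with $n<k\le n+p-1$, does there exist a finite sequence of topplings, starting from the configuration obtained from $x$ by adding one grain at column $1$, that leads to a configuration with at least one grain in column $k$? An instance $(x,k)$ is given as a binary word by the offset $k-n$ followed by the sequence of height differences $x_1-x_2,\dots,x_{n-1}-x_n,x_n$, where each number $m$ is written as $1^m0$. Theorem. For every fixed integer $p>1$, the problem $\mathrm{AP}$ is in $\mathsf{NC}^1$, that is, the language of the encodings of its positive instances is decided by a logarithmic-space uniform family of Boolean circuits of fan-in at most two,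 of polynomial size and of depth $O(\log N)$, where $N$ is the length of the input. (Logarithmic-space uniform: a description of the circuit for inputs of length $N$ can be computed from $1^N$ by a deterministic Turing machine in work space $O(\log N)$.) -/

import Mathlib

/-! ### The one-dimensional Kadanoff sandpile -/

namespace KSPM

/-- A configuration assigns to every site of `ℤ` its sand content. -/
abbrev Config : Type := ℤ → ℤ

/-- `x` is monotone (non-increasing from left to right). -/
def Monotone (x : Config) : Prop := ∀ i : ℤ, x (i + 1) ≤ x i

/-- `x` is stable for Kadanoff's parameter `p`. -/
def Stable (p : ℕ) (x : Config) : Prop := ∀ i : ℤ, x i - x (i + 1) < p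

/-- Stable monotone configurations `… x₁ x₁ x₁, x₂, …, xₙ, 0 0 0 …` of length `n`: the content is
constant to the left of column `1`, and column `n` is the last one with non-zero content. -/
structure SM (p n : ℕ) (x : Config) : Prop where
  pos : 1 ≤ n
  left : ∀ i : ℤ, i < 1 → x i = x 1
  last : x n ≠ 0
  right : ∀ i : ℤ, (n : ℤ) < i → x i = 0
  monotone : Monotone x
  stable : Stable p x

/-- Add one grain at site `i`. -/
def addGrain (x : Config) (i : ℤ) : Config := Function.update x i (x i + 1)

/-- The result of a toppling at site `i`: it loses `p - 1` grains, and each of the `p - 1` sites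
`i + 1, …, i + p - 1` receives one. -/
def topple (p : ℕ) (x : Config) (i : ℤ) : Config := fun j =>
  if j = i then x j - ((p : ℤ) - 1)
  else if i < j ∧ j ≤ i + (p : ℤ) - 1 then x j + 1
  else x j

/-- One step of the dynamics: some site `i` with `x i - x (i + 1) ≥ p` topples. -/
def Step (p : ℕ) (x y : Config) : Prop :=
  ∃ i : ℤ, (p : ℤ) ≤ x i - x (i + 1) ∧ y = topple p x i

/-- Some sequence of topplings after the addition of a grain at column `1` leads to a
configuration with at least one grain in column `k`. -/
def AvalancheReaches (p : ℕ) (x : Config) (k : ℕ) : Prop :=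
  ∃ y : Config, Relation.ReflTransGen (Step p) (addGrain x 1) y ∧ 1 ≤ y k

/-- The word `1ᵐ0`. -/
def unary (m : ℕ) : List Bool := List.replicate m true ++ [false]

/-- The binary word that encodes the instance `(x, k)`, where `x` has length `n` and `n < k`: the
offset `k - n`, followed by the height differences `x₁ - x₂, …, xₙ₋₁ - xₙ, xₙ - 0`, every number
`m` being written as `1ᵐ0`. -/
def encodeInstance (n : ℕ) (x : Config) (k : ℕ) : List Bool :=
  unary (k - n) ++
    (List.range n).flatMap fun i => unary (x ((i : ℤ) + 1) - x ((i : ℤ) + 2)).toNat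

/-- The avalanche problem `AP` for the parameter `p`, as the language of the encodings of its
positive instances. -/
def AP (p : ℕ) : Language Bool :=
  {w | ∃ (n : ℕ) (x : Config) (k : ℕ), SM p n x ∧ n < k ∧ k ≤ n + p - 1 ∧
    w = encodeInstance n x k ∧ AvalancheReaches p x k}

end KSPM

/-! ### Boolean circuits of bounded fan-in -/

namespace Circ

/-- Gates of fan-in at most two. An `input` gate reads an input bit (numbered from `0`); the
arguments of the other gates are the numbers (from `0`) of earlier gates of the circuit. -/
inductive Gate : Type
  | input (i : ℕ)
  | const (b : Bool)
  | not (j : ℕ)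
  | and (j k : ℕ)
  | or (j k : ℕ)

/-- A circuit is the list of its gates in topological order; the last gate is the output. -/
abbrev Circuit : Type := List Gate

/-- Gate number `m` of a circuit with `n` inputs refers only to existing inputs and to gates with
smaller numbers. -/
def Gate.WellFormed (n m : ℕ) : Gate → Prop
  | .input i => i < n
  | .const _ => True
  | .not j => j < m
  | .and j k => j < m ∧ k < m
  | .or j k => j < m ∧ k < m

/-- `C` is a circuit with `n` inputs and one output. -/
def Circuit.WellFormed (n : ℕ) (C : Circuit) : Prop :=
  C ≠ [] ∧ ∀ (m : ℕ) (h : m < C.length), (C[m]'h).WellFormed n m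

/-- The value of a gate on the input word `x`, from the values `v` of the earlier gates. -/
def Gate.value (x v : List Bool) : Gate → Bool
  | .input i => x.getD i false
  | .const b => b
  | .not j => !(v.getD j false)
  | .and j k => v.getD j false && v.getD k false
  | .or j k => v.getD j false || v.getD k false

/-- The values of all gates. -/
def Circuit.values (x : List Bool) (C : Circuit) : List Bool :=
  C.foldl (fun v g => v ++ [g.value x v]) []

/-- The output of the circuit. -/
def Circuit.eval (x : List Bool) (C : Circuit) : Bool :=
  (Circuit.values x C).getLastD false

/-- The depth of a gate, from the depths `d` of the earlier gates. -/
def Gate.depth (d : List ℕ) : Gate → ℕ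
  | .input _ => 0
  | .const _ => 0
  | .not j => d.getD j 0 + 1
  | .and j k => max (d.getD j 0) (d.getD k 0) + 1
  | .or j k => max (d.getD j 0) (d.getD k 0) + 1

/-- The depths of all gates. -/
def Circuit.depths (C : Circuit) : List ℕ :=
  C.foldl (fun d g => d ++ [g.depth d]) []

/-- The depth of a circuit: the length of a longest path. -/
def Circuit.depth (C : Circuit) : ℕ := (Circuit.depths C).foldr max 0

/-- Binary description of a gate: its kind and its arguments, each number `m` written as `1ᵐ0`. -/
def Gate.encode : Gate → List Bool
  | .input i => KSPM.unary 0 ++ KSPM.unary i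
  | .const b => KSPM.unary 1 ++ KSPM.unary b.toNat
  | .not j => KSPM.unary 2 ++ KSPM.unary j
  | .and j k => KSPM.unary 3 ++ KSPM.unary j ++ KSPM.unary k
  | .or j k => KSPM.unary 4 ++ KSPM.unary j ++ KSPM.unary k

/-- Binary description of a circuit, of length polynomial in its size and number of inputs. -/
def Circuit.encode (C : Circuit) : List Bool := C.flatMap Gate.encode

end Circ

/-! ### Space-bounded Turing machines with output -/

namespace TM

/-- Moves of a head. -/
inductive Move : Type
  | left
  | stay
  | right

/-- Contents of a cell of the input tape: an end marker or a bit of the input. -/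
inductive Cell : Type
  | leftEnd
  | bit (b : Bool)
  | rightEnd

/-- A deterministic Turing machine with a two-way read-only input tape, `tapes` one-way infinite
work tapes and a write-only one-way output tape. From the state, the input cell read and the
symbols read on the work tapes, `δ` gives the new state, the move of the input head, what is
written on each work tape and how its head moves, and the bit (if any) appended to the output; the
machine halts where `δ` is `none`. -/
structure Machine where
  State : Type
  finiteState : Finite State
  Symbol : Type
  finiteSymbol : Finite Symbol
  tapes : ℕ
  start : State
  blank : Symbol
  δ : State → Cell → (Fin tapes → Symbol) →
    Option (State × Move × (Fin tapes → Symbol × Move) × Option Bool)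

/-- Configurations of a machine. -/
structure Machine.Cfg (M : Machine) where
  state : M.State
  inputHead : ℕ
  tape : Fin M.tapes → ℕ → M.Symbol
  head : Fin M.tapes → ℕ
  output : List Bool

/-- New position of a head; a move to the left from cell `0` has no effect. -/
def Move.apply : Move → ℕ → ℕ
  | .left, a => a - 1
  | .stay, a => a
  | .right, a => a + 1

/-- The input `w` is in the cells `1, …, |w|`, between end markers in the cells `0` and
`|w| + 1`. -/
def inputCell (w : List Bool) (a : ℕ) : Cell :=
  if a = 0 then .leftEnd
  else match w[a - 1]? with
    | some b => .bit b
    | none => .rightEnd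

/-- The initial configuration: all heads in cell `0`, all work tapes blank, empty output. -/
def Machine.init (M : Machine) : M.Cfg where
  state := M.start
  inputHead := 0
  tape := fun _ _ => M.blank
  head := fun _ => 0
  output := []

/-- One step on input `w`. The input head does not leave the cells `0, …, |w| + 1`. -/
def Machine.step (M : Machine) (w : List Bool) (c : M.Cfg) : Option M.Cfg :=
  (M.δ c.state (inputCell w c.inputHead) (fun t => c.tape t (c.head t))).map
    fun (q, mv, act, o) =>
      { state := q
        inputHead := min (mv.apply c.inputHead) (w.length + 1)
        tape := fun t => Function.update (c.tape t) (c.head t) (act t).1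
        head := fun t => (act t).2.apply (c.head t)
        output := c.output ++ o.toList }

/-- On input `w`, the machine halts with output `out`, and during the whole computation every work
head stays in the first `s` cells of its tape. -/
def Machine.ComputesInSpace (M : Machine) (w out : List Bool) (s : ℕ) : Prop :=
  (∃ c, StateTransition.Reaches (M.step w) M.init c ∧ M.step w c = none ∧ c.output = out) ∧
    ∀ c, StateTransition.Reaches (M.step w) M.init c → ∀ t, c.head t < s

end TM

/-! ### The class NC¹ -/

/-- The family `C` is logarithmic-space uniform: `1ⁿ ↦ Cₙ` is computed in space `O(log n)`. -/
def LogspaceUniform (C : ℕ → Circ.Circuit) : Prop :=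
  ∃ (M : TM.Machine) (a : ℕ), ∀ n : ℕ,
    M.ComputesInSpace (List.replicate n true) (Circ.Circuit.encode (C n)) (a * Nat.log 2 n + a)

/-- `L` is in (logarithmic-space uniform) NC¹: it is decided by a uniform family of Boolean
circuits of fan-in at most two, of polynomial size and logarithmic depth. -/
def InNC1 (L : Language Bool) : Prop :=
  ∃ C : ℕ → Circ.Circuit,
    (∀ n, (C n).WellFormed n) ∧
    (∀ w : List Bool, w ∈ L ↔ (C w.length).eval w = true) ∧
    (∃ a : ℕ, ∀ n, (C n).length ≤ n ^ a + a) ∧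
    (∃ a : ℕ, ∀ n, (C n).depth ≤ a * Nat.log 2 n + a) ∧
    LogspaceUniform C

/-!
In the avalanche that a grain added to a stable monotone configuration triggers, every site topples
at most once, so its result is determined by the set of the sites fired. This set is the least
barrier: the least set of sites closed under the local rule that makes a site topple because of the
sites at distance at most `p - 1` from it. Hence column `k > n` receives a grain if and only if
every barrier meets the sites `k - p + 1, …, n`, and a finite automaton decides this by keeping the
set of all possible contents of a barrier in the last `p` sites; so `AP p` is a regular language.

A regular language is in NC¹ because membership depends on the product, in the finite transition
monoid, of the letters of the word, which a balanced binary tree of blocks of constant size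
computes. The blocks are so regular that the description of the circuit is written by a program with
a bounded number of polynomially bounded counters, which a Turing machine holds in binary.
-/

/-! ### Avalanches and barriers -/

namespace KSPM

section Fire

variable {p : ℕ}

/-- The result of toppling every site `i` of `x` exactly `t i` times, in the absence of any
stability condition: `t` is the shot vector of the sequence of topplings. -/
noncomputable def fire (p : ℕ) (x : Config) (t : ℤ → ℤ) : Config := fun j =>
  x j - ((p : ℤ) - 1) * t j + ∑ m ∈ Finset.Ico (j - p + 1) j, t m

theorem fire_sub_fire (hp : 0 < p) (x : Config) (t : ℤ → ℤ) (i : ℤ) :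
    fire p x t i - fire p x t (i + 1) =
      x i - x (i + 1) - p * t i + ((p : ℤ) - 1) * t (i + 1) + t (i + 1 - p) := by
  have left_window : ∑ m ∈ Finset.Ico (i - p + 1) (i + 1), t m =
      ∑ m ∈ Finset.Ico (i - p + 1) i, t m + t i := by
    rw [← Finset.insert_Ico_right_eq_Ico_add_one (by omega), Finset.sum_insert (by simp), add_comm]
  have right_window : ∑ m ∈ Finset.Ico (i - p + 1) (i + 1), t m =
      t (i + 1 - p) + ∑ m ∈ Finset.Ico (i + 1 - p + 1) (i + 1), t m := by
    rw [show i + 1 - (p : ℤ) = i - p + 1 by ring,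
      ← Finset.insert_Ico_add_one_left_eq_Ico (by omega), Finset.sum_insert (by simp)]
  simp only [fire]
  linarith

theorem topple_fire (x : Config) (t : ℤ → ℤ) (i : ℤ) :
    topple p (fire p x t) i = fire p x (t + Pi.single i 1) := by
  have received (j : ℤ) : ∑ m ∈ Finset.Ico (j - p + 1) j, (Pi.single i 1 : ℤ → ℤ) m =
      if i < j ∧ j ≤ i + (p : ℤ) - 1 then 1 else 0 := by
    simp only [Finset.sum_pi_single', Finset.mem_Ico]
    exact if_congr (by omega) rfl rfl
  ext j
  simp only [topple, fire, Pi.add_apply, Finset.sum_add_distrib, received]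
  rcases eq_or_ne j i with rfl | hji
  · simp only [if_true, Pi.single_eq_same, lt_self_iff_false, false_and, if_false]
    ring
  · simp only [if_neg hji, Pi.single_eq_of_ne hji]
    split_ifs <;> ring

theorem topple_congr {x y : Config} {j : ℤ} (h : x j = y j) (i : ℤ) :
    topple p x i j = topple p y i j := by
  simp only [topple, h]

end Fire

/-- `y` is obtained from `x` by adding a grain at column `1` and then toppling every site of the
set `T` once, except that the added grain is encoded as a toppling of site `2 - p`. This has the
right effect on the columns `1, 2, …`; the columns to their left do not change. -/
structure Fired (p n : ℕ) (x y : Config) (T : Set ℤ) : Prop where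
  source : 2 - (p : ℤ) ∈ T
  subset : T ⊆ insert (2 - (p : ℤ)) (Set.Icc 1 n)
  left : ∀ j ≤ 0, y j = x 1
  right : ∀ j, 1 ≤ j → y j = fire p x (T.indicator 1) j

/-- A set of sites that contains every site able to topple after the addition of a grain at
column `1`, for the height differences `ds`: if the topplings in `X` of sites `i + 1` and
`i + 1 - p`, which send grains away from column `i + 1` and to column `i`, make site `i` unstable,
then `i ∈ X`. As in `Fired`, site `2 - p` stands for the added grain. -/
structure IsBarrier (p : ℕ) (ds : List ℕ) (X : Set ℤ) : Prop where
  mem_iff : ∀ i ≤ 0, i ∈ X ↔ i = 2 - (p : ℤ)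
  closed : ∀ (i : ℕ) (h : i < ds.length),
    (p : ℤ) ≤ ds[i] + ((p : ℤ) - 1) * X.indicator 1 (i + 2 : ℤ) + X.indicator 1 (i + 2 - p : ℤ) →
      (i + 1 : ℤ) ∈ X

/-- The height differences `x₁ - x₂, …, xₙ - xₙ₊₁` of a configuration. -/
def slopes (n : ℕ) (x : Config) : List ℕ :=
  (List.range n).map fun i : ℕ => (x ((i : ℤ) + 1) - x ((i : ℤ) + 2)).toNat

theorem length_slopes (n : ℕ) (x : Config) : (slopes n x).length = n := by
  simp [slopes]

theorem getElem_slopes {p n : ℕ} {x : Config} (hx : SM p n x) (i : ℕ)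
    (h : i < (slopes n x).length) :
    ((slopes n x)[i] : ℤ) = x ((i : ℤ) + 1) - x ((i : ℤ) + 2) := by
  have := hx.monotone (i + 1)
  simp only [slopes, List.getElem_map, List.getElem_range]
  rw [Int.toNat_of_nonneg]
  rw [show (i : ℤ) + 2 = i + 1 + 1 by ring]
  omega

theorem indicator_one_nonneg (T : Set ℤ) (i : ℤ) : 0 ≤ T.indicator (1 : ℤ → ℤ) i :=
  Set.indicator_nonneg (fun _ _ => zero_le_one) i

theorem indicator_one_le_one (T : Set ℤ) (i : ℤ) : T.indicator (1 : ℤ → ℤ) i ≤ 1 :=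
  Set.indicator_le_self' (fun _ _ => zero_le_one) i

namespace Fired

variable {p n : ℕ} {x y : Config} {T : Set ℤ} {i : ℤ}

theorem notMem (h : Fired p n x y T) (hi : i ≤ 0 ∧ i ≠ 2 - (p : ℤ) ∨ (n : ℤ) < i) (hp : 1 < p) :
    i ∉ T := by
  intro hiT
  rcases h.subset hiT with rfl | hiT
  · omega
  · rw [Set.mem_Icc] at hiT
    omega

theorem slope (h : Fired p n x y T) (hp : 0 < p) (hi : 1 ≤ i) :
    y i - y (i + 1) = x i - x (i + 1) - p * T.indicator 1 i +
      ((p : ℤ) - 1) * T.indicator 1 (i + 1) + T.indicator 1 (i + 1 - p) := by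
  rw [h.right i hi, h.right (i + 1) (by omega), fire_sub_fire hp]

theorem one_le_of_unstable (h : Fired p n x y T) (hp : 0 < p) (hi : (p : ℤ) ≤ y i - y (i + 1)) :
    1 ≤ i := by
  by_contra! hi0
  rw [h.left i (by omega)] at hi
  rcases eq_or_ne i 0 with rfl | hi1
  · have hsum : 0 ≤ ∑ m ∈ Finset.Ico ((1 : ℤ) - p + 1) 1, T.indicator (1 : ℤ → ℤ) m :=
      Finset.sum_nonneg fun m _ => indicator_one_nonneg T m
    have hmul := mul_le_mul_of_nonneg_left (indicator_one_le_one T 1) (by omega : 0 ≤ (p : ℤ) - 1)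
    rw [zero_add, h.right 1 le_rfl, fire] at hi
    linarith
  · rw [h.left (i + 1) (by omega)] at hi
    omega

/-- A fired site has lost `p` units of slope, and its neighbours can restore at most `p`. -/
theorem notMem_of_unstable (h : Fired p n x y T) (hx : SM p n x) (hp : 0 < p)
    (hi : (p : ℤ) ≤ y i - y (i + 1)) : i ∉ T := by
  intro hiT
  have hmul := mul_le_mul_of_nonneg_left (indicator_one_le_one T (i + 1))
    (by omega : 0 ≤ (p : ℤ) - 1)
  have := indicator_one_le_one T (i + 1 - p)
  have := hx.stable i
  rw [h.slope hp (h.one_le_of_unstable hp hi), Set.indicator_of_mem hiT, Pi.one_apply] at hi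
  linarith

theorem le_of_unstable (h : Fired p n x y T) (hx : SM p n x) (hp : 1 < p)
    (hi : (p : ℤ) ≤ y i - y (i + 1)) : i ≤ n := by
  by_contra! hin
  have h1 := h.one_le_of_unstable (by omega) hi
  have := indicator_one_le_one T (i + 1 - p)
  rw [h.slope (by omega) h1, hx.right i hin, hx.right (i + 1) (by omega),
    Set.indicator_of_notMem (h.notMem (.inr hin) hp),
    Set.indicator_of_notMem (h.notMem (i := i + 1) (.inr (by omega)) hp)] at hi
  linarith

theorem topple (h : Fired p n x y T) (hx : SM p n x) (hp : 1 < p)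
    (hi : (p : ℤ) ≤ y i - y (i + 1)) : Fired p n x (topple p y i) (insert i T) where
  source := .inr h.source
  subset := Set.insert_subset (.inr ⟨h.one_le_of_unstable (by omega) hi, h.le_of_unstable hx hp hi⟩)
    h.subset
  left j hj := by
    have := h.one_le_of_unstable (by omega) hi
    rw [← h.left j hj, KSPM.topple, if_neg (by omega), if_neg (by omega)]
  right j hj := by
    have indicator_insert : (insert i T).indicator (1 : ℤ → ℤ) = T.indicator 1 + Pi.single i 1 := by
      rw [← Set.singleton_union, Set.indicator_union_of_disjoint
        (Set.disjoint_singleton_left.2 (h.notMem_of_unstable hx (by omega) hi)),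
        Set.indicator_singleton, add_comm, Pi.one_apply]
      rfl
    rw [topple_congr (h.right j hj), topple_fire, indicator_insert]

theorem addGrain (hx : SM p n x) (hp : 1 < p) : Fired p n x (addGrain x 1) {2 - (p : ℤ)} where
  source := rfl
  subset := by simp
  left j hj := by rw [KSPM.addGrain, Function.update_of_ne (by omega), hx.left j (by omega)]
  right j hj := by
    have hsum : ∑ m ∈ Finset.Ico (j - p + 1) j, (Pi.single (2 - (p : ℤ)) 1 : ℤ → ℤ) m =
        if j = 1 then 1 else 0 := by
      simp only [Finset.sum_pi_single', Finset.mem_Ico]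
      exact if_congr (by omega) rfl rfl
    rw [fire, Set.indicator_singleton, Pi.one_apply, hsum,
      Pi.single_eq_of_ne (by omega : j ≠ 2 - (p : ℤ))]
    split_ifs with hj1 <;> simp [KSPM.addGrain, hj1]

theorem eq_sum_of_lt (h : Fired p n x y T) (hx : SM p n x) (hp : 1 < p) (hi : (n : ℤ) < i) :
    y i = ∑ m ∈ Finset.Ico (i - p + 1) i, T.indicator (1 : ℤ → ℤ) m := by
  rw [h.right i (by omega), fire, hx.right i hi, Set.indicator_of_notMem (h.notMem (.inr hi) hp)]
  ring

end Fired

section Avalanche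

variable {p n : ℕ} {x : Config}

theorem IsBarrier.mem_of_unstable {X T : Set ℤ} {y : Config} {i : ℤ}
    (hX : IsBarrier p (slopes n x) X) (hTX : T ⊆ X) (h : Fired p n x y T) (hx : SM p n x)
    (hp : 1 < p) (hi : (p : ℤ) ≤ y i - y (i + 1)) : i ∈ X := by
  have h1 := h.one_le_of_unstable (by omega) hi
  have hn := h.le_of_unstable hx hp hi
  have hmono (j : ℤ) : T.indicator (1 : ℤ → ℤ) j ≤ X.indicator 1 j :=
    Set.indicator_le_indicator_of_subset hTX (fun _ => zero_le_one) j
  have hiT := h.notMem_of_unstable hx (by omega) hi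
  rw [h.slope (by omega) h1, Set.indicator_of_notMem hiT] at hi
  obtain ⟨m, rfl⟩ : ∃ m : ℕ, i = m + 1 := ⟨(i - 1).toNat, by omega⟩
  refine hX.closed m (by rw [length_slopes]; omega) ?_
  rw [getElem_slopes hx]
  rw [show (m : ℤ) + 1 + 1 = m + 2 by ring] at hi
  have := mul_le_mul_of_nonneg_left (hmono (m + 2)) (by omega : 0 ≤ (p : ℤ) - 1)
  have := hmono (m + 2 - p)
  linarith

theorem exists_fired_of_reaches (hx : SM p n x) (hp : 1 < p) {y : Config}
    (hy : Relation.ReflTransGen (Step p) (addGrain x 1) y) :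
    ∃ T, Fired p n x y T ∧ ∀ X, IsBarrier p (slopes n x) X → T ⊆ X := by
  induction hy with
  | refl =>
    exact ⟨_, Fired.addGrain hx hp, fun X hX =>
      Set.singleton_subset_iff.2 ((hX.mem_iff _ (by omega)).2 rfl)⟩
  | tail _ hstep ih =>
    obtain ⟨T, hT, hTX⟩ := ih
    obtain ⟨i, hi, rfl⟩ := hstep
    exact ⟨_, hT.topple hx hp hi, fun X hX =>
      Set.insert_subset (hX.mem_of_unstable (hTX X hX) hT hx hp hi) (hTX X hX)⟩

theorem exists_fired_isBarrier (hx : SM p n x) (hp : 1 < p) :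
    ∃ y T, Relation.ReflTransGen (Step p) (addGrain x 1) y ∧ Fired p n x y T ∧
      IsBarrier p (slopes n x) T := by
  have hfin : {T | ∃ y, Relation.ReflTransGen (Step p) (addGrain x 1) y ∧
      Fired p n x y T}.Finite :=
    ((Set.finite_Icc _ _).insert _).finite_subsets.subset fun _ ⟨_, _, hT⟩ => hT.subset
  obtain ⟨T, ⟨y, hy, hT⟩, hmax⟩ := hfin.exists_maximal
    ⟨_, _, .refl, Fired.addGrain hx hp⟩
  have hstable (i : ℤ) : y i - y (i + 1) < p := by
    by_contra! hi
    exact hT.notMem_of_unstable hx (by omega) hi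
      (hmax ⟨_, hy.tail ⟨i, hi, rfl⟩, hT.topple hx hp hi⟩ (Set.subset_insert i T)
        (Set.mem_insert i T))
  refine ⟨y, T, hy, hT, fun i hi => ⟨fun hiT => ?_, ?_⟩, fun i hi hthr => ?_⟩
  · by_contra hne
    exact hT.notMem (.inl ⟨hi, hne⟩) hp hiT
  · rintro rfl
    exact hT.source
  · by_contra hiT
    have hlt := hstable (i + 1)
    rw [hT.slope (by omega) (by omega), Set.indicator_of_notMem hiT,
      show (i : ℤ) + 1 + 1 = i + 2 by ring] at hlt
    rw [getElem_slopes hx] at hthr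
    linarith

theorem avalancheReaches_iff (hx : SM p n x) (hp : 1 < p) {k : ℕ} (hnk : n < k) :
    AvalancheReaches p x k ↔ ∀ X, IsBarrier p (slopes n x) X →
      ∃ j ∈ X, (k : ℤ) - p + 1 ≤ j ∧ j ≤ n + 1 := by
  constructor
  · rintro ⟨y, hy, hyk⟩ X hX
    obtain ⟨T, hT, hTX⟩ := exists_fired_of_reaches hx hp hy
    rw [hT.eq_sum_of_lt hx hp (by omega)] at hyk
    obtain ⟨j, hj, hjT⟩ := Finset.exists_ne_zero_of_sum_ne_zero (zero_lt_one.trans_le hyk).ne'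
    have hjT := Set.mem_of_indicator_ne_zero hjT
    refine ⟨j, hTX X hX hjT, (Finset.mem_Ico.1 hj).1, ?_⟩
    by_contra! hjn
    exact hT.notMem (.inr (by omega)) hp hjT
  · intro h
    obtain ⟨y, T, hy, hT, hTX⟩ := exists_fired_isBarrier hx hp
    obtain ⟨j, hjT, hkj, -⟩ := h T hTX
    refine ⟨y, hy, ?_⟩
    rw [hT.eq_sum_of_lt hx hp (by omega)]
    have hj : j ∈ Finset.Ico ((k : ℤ) - p + 1) k := by
      by_contra hj
      exact hT.notMem (.inr (by rw [Finset.mem_Ico] at hj; omega)) hp hjT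
    calc (1 : ℤ) = T.indicator 1 j := by rw [Set.indicator_of_mem hjT, Pi.one_apply]
      _ ≤ _ := Finset.single_le_sum (fun m _ => indicator_one_nonneg T m) hj

end Avalanche

end KSPM

/-! ### An automaton for the avalanche problem -/

namespace KSPM

section UnaryDFA

variable {p : ℕ} [NeZero p] {σ : Type*} (M : DFA (Fin p) σ)

/-- The automaton that simulates `M` on words over `Bool` which encode the letters of `M` in
unary. A state consists of the state of `M` and the number of ones read since the last zero. -/
def unaryDFA : DFA Bool (Option (σ × Fin p)) where
  step s b := s.bind fun (q, c) =>
    if b then if h : c.val + 1 < p then some (q, ⟨c + 1, h⟩) else none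
    else some (M.step q c, 0)
  start := some (M.start, 0)
  accept := {s | ∃ q ∈ M.accept, s = some (q, 0)}

theorem unaryDFA_evalFrom_replicate_true (q : σ) (c : ℕ) (h : c < p) :
    (unaryDFA M).evalFrom (some (q, 0)) (List.replicate c true) = some (q, ⟨c, h⟩) := by
  induction c with
  | zero => rfl
  | succ c ih =>
    rw [List.replicate_succ', DFA.evalFrom_append_singleton, ih (by omega)]
    simp [unaryDFA, h]

theorem unaryDFA_eval_flatMap_unary (l : List (Fin p)) :
    (unaryDFA M).eval (l.flatMap fun c : Fin p => unary c) = some (M.eval l, 0) := by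
  induction l using List.reverseRecOn with
  | nil => rfl
  | append_singleton l c ih =>
    rw [List.flatMap_append, List.flatMap_singleton, unary, ← List.append_assoc,
      DFA.eval_append_singleton, DFA.eval, DFA.evalFrom_of_append, ← DFA.eval, ih,
      unaryDFA_evalFrom_replicate_true M _ c c.isLt, DFA.eval_append_singleton]
    rfl

theorem eq_flatMap_unary_of_unaryDFA_eval {w : List Bool} {q : σ} {c : Fin p}
    (h : (unaryDFA M).eval w = some (q, c)) :
    ∃ l : List (Fin p), w = (l.flatMap fun c : Fin p => unary c) ++ List.replicate c true ∧
      M.eval l = q := by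
  induction w using List.reverseRecOn generalizing q c with
  | nil =>
    cases h
    exact ⟨[], rfl, rfl⟩
  | append_singleton w b ih =>
    rw [DFA.eval_append_singleton] at h
    obtain ⟨⟨q', c'⟩, hw, hstep⟩ := Option.bind_eq_some_iff.1 h
    obtain ⟨l, rfl, rfl⟩ := ih hw
    cases b with
    | false =>
      cases hstep
      exact ⟨l ++ [c'], by simp [unary], M.eval_append_singleton l c'⟩
    | true =>
      simp only [if_true] at hstep
      split_ifs at hstep
      cases hstep
      exact ⟨l, by simp [List.replicate_succ'], rfl⟩

theorem accepts_unaryDFA :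
    (unaryDFA M).accepts = {w | ∃ l ∈ M.accepts, w = l.flatMap fun c : Fin p => unary c} := by
  ext w
  constructor
  · rintro ⟨q, hq, hw⟩
    obtain ⟨l, rfl, rfl⟩ := eq_flatMap_unary_of_unaryDFA_eval M hw
    exact ⟨l, hq, by simp⟩
  · rintro ⟨l, hl, rfl⟩
    exact ⟨_, hl, unaryDFA_eval_flatMap_unary M l⟩

theorem isRegular_flatMap_unary {L : Language (Fin p)} (hL : L.IsRegular) :
    Language.IsRegular ({w | ∃ l ∈ L, w = l.flatMap fun c : Fin p => unary c} : Language Bool) := by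
  obtain ⟨σ, _, M, rfl⟩ := hL
  exact ⟨_, inferInstance, unaryDFA M, accepts_unaryDFA M⟩

end UnaryDFA

section Windows

theorem IsBarrier.congr {p : ℕ} {ds : List ℕ} {X Y : Set ℤ} (hX : IsBarrier p ds X)
    (h : ∀ i ≤ (ds.length : ℤ) + 1, i ∈ X ↔ i ∈ Y) (hp : 0 < p) : IsBarrier p ds Y where
  mem_iff i hi := by rw [← h i (by omega), hX.mem_iff i hi]
  closed i hi := by
    classical
    simp only [Set.indicator_apply, ← h (i + 2) (by omega), ← h (i + 2 - p) (by omega),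
      ← h (i + 1) (by omega)]
    simpa only [Set.indicator_apply] using hX.closed i hi

theorem isBarrier_append_singleton {p : ℕ} {ds : List ℕ} {d : ℕ} {X : Set ℤ} :
    IsBarrier p (ds ++ [d]) X ↔ IsBarrier p ds X ∧
      ((p : ℤ) ≤ d + ((p : ℤ) - 1) * X.indicator 1 (ds.length + 2 : ℤ) +
        X.indicator 1 (ds.length + 2 - p : ℤ) → (ds.length + 1 : ℤ) ∈ X) := by
  refine ⟨fun h => ⟨⟨h.mem_iff, fun i hi => ?_⟩, ?_⟩, fun h => ⟨h.1.mem_iff, fun i hi => ?_⟩⟩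
  · have := h.closed i (by simp only [List.length_append]; omega)
    rwa [List.getElem_append_left hi] at this
  · simpa using h.closed ds.length (by simp)
  · rcases lt_or_ge i ds.length with hi' | hi'
    · rw [List.getElem_append_left hi']
      exact h.1.closed i hi'
    · obtain rfl : i = ds.length := by
        rw [List.length_append, List.length_singleton] at hi
        omega
      simpa using h.2

/-- The part of `X` in the last `p` sites up to site `n + 1`, numbered from right to left. -/
def lastSites (p n : ℕ) (X : Set ℤ) : Set (Fin p) := {j | (n : ℤ) + 1 - j ∈ X}

/-- The possible contents of a barrier in the last `p` sites up to the first one after those of the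
height differences `ds`. -/
def windows (p : ℕ) (ds : List ℕ) : Set (Set (Fin p)) :=
  lastSites p ds.length '' {X | IsBarrier p ds X}

/-- The windows of `ds ++ [d]`, from those of `ds`: the window moves by one site to the right, and
the site that has its two neighbours at distances `1` and `p - 1` in the union of the old and the
new window has to satisfy the condition of `IsBarrier`. -/
def nextWindows {q : ℕ} (d : ℕ) (W : Set (Set (Fin (q + 1)))) : Set (Set (Fin (q + 1))) :=
  {v' | ∃ v ∈ W,
    ((q : ℤ) + 1 ≤ d + q * v'.indicator 1 0 + v.indicator 1 (Fin.last q) → 0 ∈ v) ∧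
      ∀ j : Fin q, j.succ ∈ v' ↔ j.castSucc ∈ v}

theorem windows_append_singleton {q : ℕ} (hq : 0 < q) (ds : List ℕ) (d : ℕ) :
    windows (q + 1) (ds ++ [d]) = nextWindows d (windows (q + 1) ds) := by
  have step_iff (X : Set ℤ) : (((q + 1 : ℕ) : ℤ) ≤
        d + (((q + 1 : ℕ) : ℤ) - 1) * X.indicator 1 (ds.length + 2 : ℤ) +
          X.indicator 1 (ds.length + 2 - (q + 1 : ℕ) : ℤ) → (ds.length + 1 : ℤ) ∈ X) ↔
      ((q : ℤ) + 1 ≤ d + q * (lastSites (q + 1) (ds ++ [d]).length X).indicator 1 0 +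
        (lastSites (q + 1) ds.length X).indicator 1 (Fin.last q) →
          0 ∈ lastSites (q + 1) ds.length X) := by
    have e₁ : (ds.length : ℤ) + 1 + 1 = ds.length + 2 := by ring
    have e₂ : (ds.length : ℤ) + 1 - q = ds.length + 2 - (q + 1) := by ring
    classical
    simp [lastSites, Set.indicator_apply, e₁, e₂]
  have shift (X : Set ℤ) (j : Fin q) : j.succ ∈ lastSites (q + 1) (ds ++ [d]).length X ↔
      j.castSucc ∈ lastSites (q + 1) ds.length X := by
    simp [lastSites, add_sub_add_right_eq_sub]
  ext v'
  constructor
  · rintro ⟨X, hX, rfl⟩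
    obtain ⟨hX, hlast⟩ := isBarrier_append_singleton.1 hX
    exact ⟨_, ⟨X, hX, rfl⟩, (step_iff X).1 hlast, shift X⟩
  · rintro ⟨_, ⟨X, hX, rfl⟩, hlast, hshift⟩
    -- The content of `X` at site `ds.length + 2`, beyond its window, can be prescribed freely.
    let Y : Set ℤ := {i | if i = (ds.length : ℤ) + 2 then 0 ∈ v' else i ∈ X}
    have hXY (i : ℤ) (hi : i ≤ (ds.length : ℤ) + 1) : i ∈ X ↔ i ∈ Y := by
      simp [Y, show i ≠ (ds.length : ℤ) + 2 by omega]
    have hYX : lastSites (q + 1) ds.length Y = lastSites (q + 1) ds.length X := by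
      ext j
      exact (hXY _ (by omega)).symm
    have hYv : lastSites (q + 1) (ds ++ [d]).length Y = v' := by
      ext j
      cases j using Fin.cases with
      | zero => simp [lastSites, Y, add_assoc]
      | succ j => rw [shift, hYX, hshift]
    refine ⟨Y, isBarrier_append_singleton.2 ⟨hX.congr hXY (by omega), (step_iff Y).2 ?_⟩, hYv⟩
    rwa [hYv, hYX]

end Windows

section Avalanche

variable {q : ℕ}

/-- The automaton that reads the offset `o` of an instance and then its height differences. It
keeps `o`, the set of windows of the height differences read so far, and whether the last one is
non-zero. -/
noncomputable def avalancheDFA (q : ℕ) :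
    DFA (Fin (q + 1)) (Option (Fin (q + 1) × Set (Set (Fin (q + 1))) × Bool)) where
  step
    | none, o => some (o, windows (q + 1) [], false)
    | some (o, W, _), d => some (o, nextWindows d W, d != 0)
  start := none
  accept := {s | ∃ o W, s = some (o, W, true) ∧ o ≠ 0 ∧ ∀ v ∈ W, ∃ j ∈ v, j.val + o ≤ q + 1}

theorem avalancheDFA_eval_cons (hq : 0 < q) (o : Fin (q + 1)) (ds : List (Fin (q + 1))) :
    (avalancheDFA q).eval (o :: ds) =
      some (o, windows (q + 1) (ds.map Fin.val), ds.getLastD 0 != 0) := by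
  induction ds using List.reverseRecOn with
  | nil => rfl
  | append_singleton ds d ih =>
    rw [← List.cons_append, DFA.eval_append_singleton, ih, List.map_append, List.map_singleton,
      windows_append_singleton hq, List.getLastD_concat]
    rfl

theorem mem_accepts_avalancheDFA (hq : 0 < q) {l : List (Fin (q + 1))} :
    l ∈ (avalancheDFA q).accepts ↔ ∃ o ds, l = o :: ds ∧ o ≠ 0 ∧ ds.getLastD 0 ≠ 0 ∧
      ∀ v ∈ windows (q + 1) (ds.map Fin.val), ∃ j ∈ v, j.val + o ≤ q + 1 := by
  rw [DFA.mem_accepts]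
  cases l with
  | nil => simp [avalancheDFA]
  | cons o ds =>
    rw [avalancheDFA_eval_cons hq]
    constructor
    · rintro ⟨o', W, h, ho, hW⟩
      obtain ⟨rfl, rfl, hlast⟩ : o = o' ∧ windows (q + 1) (ds.map Fin.val) = W ∧
          (ds.getLastD 0 != 0) = true := by simpa using h
      exact ⟨o, ds, rfl, ho, bne_iff_ne.1 hlast, hW⟩
    · rintro ⟨_, _, ⟨⟩, ho, hlast, hW⟩
      exact ⟨o, _, by rw [bne_iff_ne.2 hlast], ho, hW⟩

theorem avalancheReaches_iff_windows {p n : ℕ} {x : Config} (hx : SM p n x) (hp : 1 < p) {o : ℕ}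
    (ho : 0 < o) : AvalancheReaches p x (n + o) ↔
      ∀ v ∈ windows p (slopes n x), ∃ j ∈ v, j.val + o ≤ p := by
  rw [avalancheReaches_iff hx hp (by omega), windows, Set.forall_mem_image]
  refine forall₂_congr fun X _ => ?_
  rw [length_slopes]
  constructor
  · rintro ⟨j, hj, hkj, hjn⟩
    push_cast at hkj
    refine ⟨⟨((n : ℤ) + 1 - j).toNat, by omega⟩, ?_, by simp only; omega⟩
    change (n : ℤ) + 1 - ((n : ℤ) + 1 - j).toNat ∈ X
    rwa [Int.toNat_of_nonneg (by omega), sub_sub_cancel]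
  · rintro ⟨j, hj, hjo⟩
    exact ⟨(n : ℤ) + 1 - j, hj, by push_cast; omega, by omega⟩

/-- The configuration with the height differences `ds` that vanishes to the right of them and is
constant to the left of column `1`. -/
def heights (ds : List ℕ) : Config := fun i => ((ds.drop (i - 1).toNat).sum : ℕ)

theorem heights_sub_heights (ds : List ℕ) (i : ℕ) :
    heights ds (i + 1) - heights ds (i + 2) = (ds.getD i 0 : ℕ) := by
  have e₁ : ((i : ℤ) + 1 - 1).toNat = i := by omega
  have e₂ : ((i : ℤ) + 2 - 1).toNat = i + 1 := by omega
  rw [heights, heights, e₁, e₂, sub_eq_iff_eq_add, ← Nat.cast_add, Nat.cast_inj]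
  rcases lt_or_ge i ds.length with hi | hi
  · rw [List.drop_eq_getElem_cons hi, List.sum_cons, List.getD_eq_getElem _ _ hi]
  · rw [List.drop_eq_nil_of_le hi, List.drop_eq_nil_of_le (by omega), List.getD_eq_default _ _ hi]
    rfl

theorem heights_of_lt_one (ds : List ℕ) {i : ℤ} (hi : i < 1) : heights ds i = heights ds 1 := by
  rw [heights, heights, show (i - 1).toNat = (1 - 1 : ℤ).toNat by omega]

theorem heights_of_length_lt {ds : List ℕ} {i : ℤ} (hi : (ds.length : ℤ) < i) :
    heights ds i = 0 := by
  rw [heights, List.drop_eq_nil_of_le (by omega), List.sum_nil, Nat.cast_zero]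

theorem slopes_heights (ds : List ℕ) : slopes ds.length (heights ds) = ds := by
  refine List.ext_getElem (length_slopes _ _) fun i _ hi => ?_
  simp only [slopes, List.getElem_map, List.getElem_range, heights_sub_heights, Int.toNat_natCast]
  exact List.getD_eq_getElem _ _ hi

theorem sm_heights {p : ℕ} {ds : List ℕ} (hds : ∀ d ∈ ds, d < p) (hlast : ds.getLastD 0 ≠ 0) :
    SM p ds.length (heights ds) := by
  have hne : ds ≠ [] := by
    rintro rfl
    exact hlast rfl
  have hp : 0 < p := (Nat.zero_le _).trans_lt (hds _ (List.getLast_mem hne))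
  have slope_bounds (i : ℤ) : 0 ≤ heights ds i - heights ds (i + 1) ∧
      heights ds i - heights ds (i + 1) < p := by
    rcases lt_trichotomy i 0 with hi | rfl | hi
    · rw [heights_of_lt_one ds (by omega : i < 1), heights_of_lt_one ds (by omega : i + 1 < 1)]
      omega
    · rw [heights_of_lt_one ds (by omega), zero_add]
      omega
    · obtain ⟨m, rfl⟩ : ∃ m : ℕ, i = m + 1 := ⟨(i - 1).toNat, by omega⟩
      rw [add_assoc, one_add_one_eq_two, heights_sub_heights]
      rcases lt_or_ge m ds.length with hm | hm
      · rw [List.getD_eq_getElem _ _ hm]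
        exact ⟨by omega, by exact_mod_cast hds _ (List.getElem_mem hm)⟩
      · rw [List.getD_eq_default _ _ hm]
        omega
  have hpos := List.length_pos_iff.2 hne
  refine ⟨hpos, fun i => heights_of_lt_one ds, ?_, fun i => heights_of_length_lt,
    fun i => sub_nonneg.1 (slope_bounds i).1, fun i => (slope_bounds i).2⟩
  have hdrop : ((ds.length : ℤ) - 1).toNat = ds.length - 1 := by omega
  rw [heights, hdrop, List.drop_length_sub_one hne, List.sum_singleton, Nat.cast_ne_zero]
  rwa [List.getLastD_eq_getLast?, List.getLast?_eq_some_getLast hne] at hlast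

theorem SM.lt_of_mem_slopes {p n : ℕ} {x : Config} (hx : SM p n x) : ∀ d ∈ slopes n x, d < p := by
  intro d hd
  obtain ⟨i, hi, rfl⟩ := List.getElem_of_mem hd
  have := hx.stable (i + 1)
  rw [add_assoc, one_add_one_eq_two, ← getElem_slopes hx i hi] at this
  exact_mod_cast this

theorem SM.getLastD_slopes_ne_zero {p n : ℕ} {x : Config} (hx : SM p n x) :
    (slopes n x).getLastD 0 ≠ 0 := by
  obtain ⟨m, rfl⟩ := Nat.exists_eq_add_of_le' hx.pos
  have hlast := hx.last
  have hzero := hx.right (m + 2) (by omega)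
  have hmono := hx.monotone (m + 1)
  rw [add_assoc, one_add_one_eq_two, hzero] at hmono
  rw [slopes, List.range_succ, List.map_append, List.map_singleton, List.getLastD_concat, hzero]
  push_cast at hlast
  omega

theorem encodeInstance_eq (n : ℕ) (x : Config) (k : ℕ) :
    encodeInstance n x k = unary (k - n) ++ (slopes n x).flatMap unary := by
  simp [encodeInstance, slopes, List.flatMap_map, List.flatMap_assoc]

theorem AP_eq (hq : 0 < q) :
    AP (q + 1) =
      {w | ∃ l ∈ (avalancheDFA q).accepts, w = l.flatMap fun c : Fin (q + 1) => unary c} := by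
  have getLastD_map_val (ds : List (Fin (q + 1))) :
      (ds.map Fin.val).getLastD 0 ≠ 0 ↔ ds.getLastD 0 ≠ 0 := by
    simp only [List.getLastD_eq_getLast?, List.getLast?_map]
    cases ds.getLast? with
    | none => simp
    | some d => exact Fin.val_ne_zero_iff
  ext w
  constructor
  · rintro ⟨n, x, k, hx, hnk, hk, rfl, hreach⟩
    obtain ⟨o, rfl⟩ := Nat.exists_eq_add_of_lt hnk
    obtain ⟨ds, hds⟩ : ∃ ds : List (Fin (q + 1)), ds.map Fin.val = slopes n x :=
      ⟨(slopes n x).pmap Fin.mk hx.lt_of_mem_slopes, by simp [List.map_pmap]⟩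
    have hlast := hx.getLastD_slopes_ne_zero
    rw [add_assoc, avalancheReaches_iff_windows hx (by omega) (by omega), ← hds] at hreach
    rw [← hds, getLastD_map_val] at hlast
    refine ⟨⟨o + 1, by omega⟩ :: ds, (mem_accepts_avalancheDFA hq).2
      ⟨_, ds, rfl, by simp [Fin.ext_iff], hlast, hreach⟩, ?_⟩
    rw [encodeInstance_eq, ← hds, List.flatMap_map, List.flatMap_cons, add_assoc,
      Nat.add_sub_cancel_left]
  · rintro ⟨l, hl, rfl⟩
    obtain ⟨o, ds, rfl, ho, hlast, hreach⟩ := (mem_accepts_avalancheDFA hq).1 hl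
    have ho : 0 < o.val := Fin.pos_iff_ne_zero.2 ho
    have hx : SM (q + 1) (ds.map Fin.val).length (heights (ds.map Fin.val)) :=
      sm_heights (List.forall_mem_map.2 fun c _ => c.isLt) ((getLastD_map_val ds).2 hlast)
    refine ⟨_, _, _ + o, hx, by omega, by omega, ?_,
      (avalancheReaches_iff_windows hx (by omega) ho).2 (by rwa [slopes_heights])⟩
    rw [encodeInstance_eq, slopes_heights, Nat.add_sub_cancel_left, List.flatMap_cons,
      List.flatMap_map]

theorem isRegular_AP {p : ℕ} (hp : 1 < p) : (AP p).IsRegular := by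
  obtain ⟨q, rfl⟩ := Nat.exists_eq_add_of_le' hp.le
  rw [AP_eq (by omega)]
  exact isRegular_flatMap_unary ⟨_, Fintype.ofFinite _, avalancheDFA q, rfl⟩

end Avalanche

end KSPM

/-! ### Circuits as concatenations of instantiated templates -/

namespace Circ

section Lists

variable {α β : Type*}

theorem append_isPrefix_drop {l₁ l₂ l : List α} {b : ℕ} :
    l₁ ++ l₂ <+: l.drop b ↔ l₁ <+: l.drop b ∧ l₂ <+: l.drop (b + l₁.length) := by
  rw [← List.drop_drop]
  constructor
  · rintro ⟨t, ht⟩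
    rw [← ht, List.append_assoc, List.drop_left]
    exact ⟨List.prefix_append _ _, List.prefix_append _ _⟩
  · rintro ⟨⟨t, ht⟩, h⟩
    rw [← ht, List.drop_left] at h
    rwa [← ht, List.prefix_append_right_inj]

theorem isPrefix_drop_trans {l₁ l₂ l₃ : List α} {b c : ℕ} (h₁ : l₁ <+: l₂.drop c)
    (h₂ : l₂ <+: l₃.drop b) : l₁ <+: l₃.drop (b + c) := by
  rw [← List.drop_drop]
  exact h₁.trans (h₂.drop c)

theorem getElem?_append_eq_some_iff {l₁ l₂ : List α} {i : ℕ} {a : α} :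
    (l₁ ++ l₂)[i]? = some a ↔
      l₁[i]? = some a ∨ ∃ j, i = l₁.length + j ∧ l₂[j]? = some a := by
  constructor
  · intro h
    rcases lt_or_ge i l₁.length with hi | hi
    · exact .inl (by rwa [List.getElem?_append_left hi] at h)
    · exact .inr ⟨_, (Nat.add_sub_of_le hi).symm, by rwa [List.getElem?_append_right hi] at h⟩
  · rintro (h | ⟨j, rfl, h⟩)
    · rw [List.getElem?_append_left (List.getElem?_eq_some_iff.1 h).1, h]
    · rw [List.getElem?_append_right (Nat.le_add_right _ _), Nat.add_sub_cancel_left, h]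

theorem getElem?_singleton_eq_some_iff {a b : α} {i : ℕ} : [a][i]? = some b ↔ i = 0 ∧ a = b := by
  cases i <;> simp

theorem getElem?_of_isPrefix_drop {l₁ l : List α} {b i : ℕ} {a : α} (h : l₁ <+: l.drop b)
    (hi : l₁[i]? = some a) : l[b + i]? = some a := by
  obtain ⟨t, ht⟩ := h
  rw [← List.getElem?_drop, ← ht, List.getElem?_append_left (List.getElem?_eq_some_iff.1 hi).1, hi]

theorem length_flatMap_of_length_eq {l : List α} {f : α → List β} {c : ℕ}
    (hf : ∀ a ∈ l, (f a).length = c) : (l.flatMap f).length = c * l.length := by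
  rw [List.length_flatMap, List.map_congr_left hf]
  simp [mul_comm]

theorem isPrefix_drop_flatMap {l : List α} {f : α → List β} {c i : ℕ} {a : α}
    (hf : ∀ a ∈ l, (f a).length = c) (hi : l[i]? = some a) :
    f a <+: (l.flatMap f).drop (c * i) := by
  obtain ⟨hlt, rfl⟩ := List.getElem?_eq_some_iff.1 hi
  have hlen : ((l.take i).flatMap f).length = c * i := by
    rw [length_flatMap_of_length_eq fun a ha => hf a (List.mem_of_mem_take ha),
      List.length_take_of_le hlt.le]
  have hsplit : l.flatMap f = (l.take i).flatMap f ++ (l.drop i).flatMap f := by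
    rw [← List.flatMap_append, List.take_append_drop]
  rw [hsplit, ← hlen, List.drop_left, List.drop_eq_getElem_cons hlt, List.flatMap_cons]
  exact List.prefix_append _ _

theorem exists_of_getElem?_flatMap {l : List α} {f : α → List β} {c m : ℕ} {b : β}
    (hf : ∀ a ∈ l, (f a).length = c) (hm : (l.flatMap f)[m]? = some b) :
    ∃ (i r : ℕ) (a : α), m = c * i + r ∧ l[i]? = some a ∧ (f a)[r]? = some b := by
  induction l generalizing m with
  | nil => simp at hm
  | cons a l ih =>
    rw [List.flatMap_cons, getElem?_append_eq_some_iff] at hm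
    obtain hm | ⟨m, rfl, hm⟩ := hm
    · exact ⟨0, m, a, by simp, rfl, hm⟩
    · obtain ⟨i, r, a', rfl, hi, hr⟩ := ih (fun a ha => hf a (List.mem_cons_of_mem _ ha)) hm
      exact ⟨i + 1, r, a', by rw [hf a List.mem_cons_self]; ring, hi, hr⟩

theorem length_foldl_concat (f : List β → α → β) (l : List α) :
    (l.foldl (fun v a => v ++ [f v a]) []).length = l.length := by
  induction l using List.reverseRecOn with
  | nil => rfl
  | append_singleton l a ih => simp [ih]

theorem getD_foldl_concat {f : List β → α → β} {d : β} {l : List α}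
    (hf : ∀ i a v v', l[i]? = some a → (∀ j < i, v.getD j d = v'.getD j d) → f v a = f v' a)
    {i : ℕ} {a : α} (hi : l[i]? = some a) :
    (l.foldl (fun v a => v ++ [f v a]) []).getD i d =
      f (l.foldl (fun v a => v ++ [f v a]) []) a := by
  induction l using List.reverseRecOn generalizing i a with
  | nil => simp at hi
  | append_singleton l b ih =>
    set V := l.foldl (fun v a => v ++ [f v a]) []
    have hV : V.length = l.length := length_foldl_concat f l
    have extend : ∀ j < l.length, V.getD j d = (V ++ [f V b]).getD j d := fun j hj =>
      (List.getD_append _ _ _ _ (by omega)).symm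
    rw [List.foldl_append, List.foldl_cons, List.foldl_nil]
    obtain hi | ⟨j, rfl, hj⟩ := getElem?_append_eq_some_iff.1 hi
    · have h := (List.getElem?_eq_some_iff.1 hi).1
      have hf' : ∀ i a v v', l[i]? = some a → (∀ j < i, v.getD j d = v'.getD j d) →
          f v a = f v' a := fun i a v v' hi =>
        hf i a v v' (getElem?_append_eq_some_iff.2 (.inl hi))
      rw [← extend i h, ih hf' hi]
      exact hf' i a _ _ hi fun j hj => extend j (by omega)
    · obtain ⟨rfl, rfl⟩ := getElem?_singleton_eq_some_iff.1 hj
      rw [Nat.add_zero, ← hV, List.getD_append_right _ _ _ _ le_rfl, Nat.sub_self,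
        List.getD_cons_zero]
      exact hf l.length b _ _ (by simp) extend

end Lists

theorem Gate.value_congr {x v v' : List Bool} {n m : ℕ} {g : Gate} (hg : g.WellFormed n m)
    (h : ∀ j < m, v.getD j false = v'.getD j false) : g.value x v = g.value x v' := by
  cases g with
  | input i => rfl
  | const b => rfl
  | not j => simp only [Gate.value, h j hg]
  | and j k => simp only [Gate.value, h j hg.1, h k hg.2]
  | or j k => simp only [Gate.value, h j hg.1, h k hg.2]

theorem Gate.depth_congr {d d' : List ℕ} {n m : ℕ} {g : Gate} (hg : g.WellFormed n m)
    (h : ∀ j < m, d.getD j 0 = d'.getD j 0) : g.depth d = g.depth d' := by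
  cases g with
  | input i => rfl
  | const b => rfl
  | not j => simp only [Gate.depth, h j hg]
  | and j k => simp only [Gate.depth, h j hg.1, h k hg.2]
  | or j k => simp only [Gate.depth, h j hg.1, h k hg.2]

namespace Circuit

variable {n m : ℕ} {C : Circuit} {g : Gate}

theorem WellFormed.of_getElem? (hC : C.WellFormed n) (hg : C[m]? = some g) :
    g.WellFormed n m := by
  obtain ⟨hm, rfl⟩ := List.getElem?_eq_some_iff.1 hg
  exact hC.2 m hm

theorem WellFormed.getD_values (hC : C.WellFormed n) (x : List Bool) (hg : C[m]? = some g) :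
    (values x C).getD m false = g.value x (values x C) :=
  getD_foldl_concat (f := fun v g => Gate.value x v g)
    (fun _ _ _ _ h => Gate.value_congr (hC.of_getElem? h)) hg

theorem WellFormed.getD_depths (hC : C.WellFormed n) (hg : C[m]? = some g) :
    (depths C).getD m 0 = g.depth (depths C) :=
  getD_foldl_concat (f := fun d g => Gate.depth d g)
    (fun _ _ _ _ h => Gate.depth_congr (hC.of_getElem? h)) hg

theorem eval_eq_getD_values (x : List Bool) (C : Circuit) :
    eval x C = (values x C).getD (C.length - 1) false := by
  have hlen : (values x C).length = C.length := length_foldl_concat (fun v g => Gate.value x v g) C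
  rw [eval, List.getLastD_eq_getLast?, List.getLast?_eq_getElem?, hlen,
    List.getD_eq_getElem?_getD]

theorem depth_le {D : ℕ} (h : ∀ m < C.length, (depths C).getD m 0 ≤ D) : C.depth ≤ D := by
  have hlen : (depths C).length = C.length := length_foldl_concat (fun d g => Gate.depth d g) C
  refine List.max_le_of_forall_le _ _ fun a ha => ?_
  obtain ⟨m, hm, rfl⟩ := List.getElem_of_mem ha
  rw [← List.getD_eq_getElem _ 0 hm]
  exact h m (hlen ▸ hm)

end Circuit

/-- The gate of a template: a block of gates that occurs in a circuit at many places. Arguments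
`(false, i)` stand for gate `i` of the block itself, arguments `(true, i)` for gate `i` of the
blocks on which it depends, which are contiguous. An `input` gate reads the input bit whose number
is a parameter of the block. -/
inductive TGate : Type
  | input
  | const (b : Bool)
  | not (u : Bool × ℕ)
  | or (u v : Bool × ℕ)

namespace TGate

/-- The number of the gate for which an argument stands in a block that starts at gate `a` and
depends on the gates from `l` on. -/
def arg (a l : ℕ) (u : Bool × ℕ) : ℕ := (bif u.1 then l else a) + u.2

/-- The gate of a circuit for which a template gate stands, in a block with input bit `x` that
starts at gate `a` and depends on the gates from `l` on. -/
def inst (x a l : ℕ) : TGate → Gate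
  | .input => .input x
  | .const b => .const b
  | .not u => .not (arg a l u)
  | .or u v => .or (arg a l u) (arg a l v)

/-- An argument of gate `m` of a block that depends on `c` gates is admissible. -/
def ValidArg (c m : ℕ) (u : Bool × ℕ) : Prop := u.2 < bif u.1 then c else m

/-- A template gate may be gate `m` of a block that depends on `c` gates, and that may read an
input bit only if `I` holds. -/
def Valid (I : Prop) (c m : ℕ) : TGate → Prop
  | .input => I
  | .const _ => True
  | .not u => ValidArg c m u
  | .or u v => ValidArg c m u ∧ ValidArg c m v

theorem ValidArg.arg_lt {a l c m : ℕ} {u : Bool × ℕ} (h : ValidArg c m u) (hl : l + c ≤ a) :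
    arg a l u < a + m := by
  obtain ⟨_ | _, i⟩ := u <;> simp only [ValidArg, arg, cond_true, cond_false] at h ⊢ <;> omega

theorem Valid.wellFormed_inst {I : Prop} {n x a l c m : ℕ} {g : TGate} (h : g.Valid I c m)
    (hx : I → x < n) (hl : l + c ≤ a) : (g.inst x a l).WellFormed n (a + m) := by
  cases g with
  | input => exact hx h
  | const b => trivial
  | not u => exact h.arg_lt hl
  | or u v => exact ⟨h.1.arg_lt hl, h.2.arg_lt hl⟩

theorem depth_le_of_valid {I : Prop} {n x a l c D m : ℕ} {C : Circuit} {T : List TGate}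
    (hC : C.WellFormed n) (hT : T.map (inst x a l) <+: C.drop a)
    (hvalid : ∀ m (g : TGate), T[m]? = some g → g.Valid I c m)
    (hD : ∀ i < c, C.depths.getD (l + i) 0 ≤ D) (hm : m < T.length) :
    C.depths.getD (a + m) 0 ≤ D + m + 1 := by
  induction m using Nat.strong_induction_on with
  | _ m ih =>
    have depth_arg (u : Bool × ℕ) (hu : ValidArg c m u) :
        C.depths.getD (arg a l u) 0 ≤ D + m := by
      obtain ⟨_ | _, i⟩ := u
      · have := ih i hu (lt_trans hu hm)
        have : i < m := hu
        simp only [arg, cond_false]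
        omega
      · exact (hD i hu).trans (Nat.le_add_right _ _)
    have hg : T[m]? = some T[m] := List.getElem?_eq_getElem hm
    have hv := hvalid m _ hg
    rw [hC.getD_depths (getElem?_of_isPrefix_drop hT (by rw [List.getElem?_map, hg]; rfl))]
    cases h : T[m] with
    | input => exact Nat.zero_le _
    | const b => exact Nat.zero_le _
    | not u =>
      rw [h] at hv
      exact Nat.succ_le_succ (depth_arg u hv)
    | or u v =>
      rw [h] at hv
      exact Nat.succ_le_succ (max_le (depth_arg u hv.1) (depth_arg v hv.2))

end TGate

/-! ### Formulas and their compilation -/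

/-- Boolean formulas over the variables `α`. -/
inductive Formula (α : Type*) : Type _
  | var (a : α)
  | const (b : Bool)
  | not (φ : Formula α)
  | or (φ ψ : Formula α)

namespace Formula

variable {α : Type*}

/-- The value of a formula. -/
def eval (v : α → Bool) : Formula α → Bool
  | .var a => v a
  | .const b => b
  | .not φ => !φ.eval v
  | .or φ ψ => φ.eval v || ψ.eval v

/-- The number of nodes of a formula. -/
def size : Formula α → ℕ
  | .var _ => 1
  | .const _ => 1
  | .not φ => φ.size + 1
  | .or φ ψ => φ.size + ψ.size + 1

theorem size_pos (φ : Formula α) : 0 < φ.size := by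
  cases φ <;> simp [size]

theorem exists_eval_eq_of_dependsOn {s : Set α} (hs : s.Finite) {f : (α → Bool) → Bool}
    (hf : DependsOn f s) : ∃ φ : Formula α, ∀ v, φ.eval v = f v := by
  classical
  induction s, hs using Set.Finite.induction_on generalizing f with
  | empty => exact ⟨const (f fun _ => false), fun v => hf (by simp)⟩
  | @insert a s _ _ ih =>
    have restrict (b : Bool) : DependsOn (fun v => f (Function.update v a b)) s := by
      intro v v' hv
      refine hf fun i hi => ?_
      rcases eq_or_ne i a with rfl | h
      · simp only [Function.update_self]
      · simp only [Function.update_of_ne h, hv i (hi.resolve_left h)]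
    obtain ⟨φ₁, h₁⟩ := ih (restrict true)
    obtain ⟨φ₀, h₀⟩ := ih (restrict false)
    -- Shannon expansion: `(a ∧ φ₁) ∨ (¬a ∧ φ₀)`.
    refine ⟨or (not (or (not (var a)) (not φ₁))) (not (or (var a) (not φ₀))), fun v => ?_⟩
    have hv := Function.update_eq_self a v
    cases hva : v a <;> rw [hva] at hv <;> simp [eval, h₁, h₀, hva, hv]

theorem exists_eval_eq [Finite α] (f : (α → Bool) → Bool) : ∃ φ : Formula α, ∀ v, φ.eval v = f v :=
  exists_eval_eq_of_dependsOn Set.finite_univ (dependsOn_univ f)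

/-- The gates that evaluate a formula in a block that already has `o` gates; the gates for the
variables are given by `atom`. -/
def compile (atom : α → TGate) : ℕ → Formula α → List TGate
  | _, .var a => [atom a]
  | _, .const b => [.const b]
  | o, .not φ => φ.compile atom o ++ [.not (false, o + φ.size - 1)]
  | o, .or φ ψ => φ.compile atom o ++ (ψ.compile atom (o + φ.size) ++
      [.or (false, o + φ.size - 1) (false, o + φ.size + ψ.size - 1)])

theorem length_compile (atom : α → TGate) (φ : Formula α) (o : ℕ) :
    (φ.compile atom o).length = φ.size := by
  induction φ generalizing o <;> simp_all [compile, size, add_assoc]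

section Value

variable {n x a l : ℕ} {w : List Bool} {C : Circuit} {atom : α → TGate} {v : α → Bool}

theorem getD_values_compile (hC : C.WellFormed n)
    (hatom : ∀ i, ((atom i).inst x a l).value w (C.values w) = v i) {φ : Formula α} {o : ℕ}
    (hφ : (φ.compile atom o).map (TGate.inst x a l) <+: C.drop (a + o)) :
    (C.values w).getD (a + (o + φ.size - 1)) false = φ.eval v := by
  have getD_of_prefix {m k : ℕ} {g : TGate} (h : [g].map (TGate.inst x a l) <+: C.drop m)
      (hk : k = m) : (C.values w).getD k false = (g.inst x a l).value w (C.values w) :=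
    hk ▸ hC.getD_values w (getElem?_of_isPrefix_drop (i := 0) h rfl)
  induction φ generalizing o with
  | var i => exact (getD_of_prefix hφ rfl).trans (hatom i)
  | const b => exact getD_of_prefix hφ rfl
  | not φ ih =>
    rw [compile, List.map_append, append_isPrefix_drop, List.length_map, length_compile] at hφ
    rw [eval, ← ih hφ.1]
    exact getD_of_prefix hφ.2 (by simp only [size]; omega)
  | or φ ψ ihφ ihψ =>
    rw [compile, List.map_append, append_isPrefix_drop, List.length_map, length_compile,
      List.map_append, append_isPrefix_drop, List.length_map, length_compile, add_assoc a] at hφ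
    rw [eval, ← ihφ hφ.1, ← ihψ hφ.2.1]
    exact getD_of_prefix hφ.2.2 (by simp only [size]; omega)

end Value

theorem valid_compile {I : Prop} {c m o : ℕ} {atom : α → TGate}
    (hatom : ∀ m i, (atom i).Valid I c m) {φ : Formula α} {g : TGate}
    (hg : (φ.compile atom o)[m]? = some g) : g.Valid I c (o + m) := by
  induction φ generalizing o m with
  | var i =>
    obtain ⟨-, rfl⟩ := getElem?_singleton_eq_some_iff.1 hg
    exact hatom _ i
  | const b =>
    obtain ⟨-, rfl⟩ := getElem?_singleton_eq_some_iff.1 hg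
    trivial
  | not φ ih =>
    obtain hφ | ⟨j, rfl, hj⟩ := getElem?_append_eq_some_iff.1 hg
    · exact ih hφ
    · obtain ⟨rfl, rfl⟩ := getElem?_singleton_eq_some_iff.1 hj
      have := φ.size_pos
      rw [length_compile]
      exact Nat.sub_lt (by omega) one_pos
  | or φ ψ ihφ ihψ =>
    obtain hφ | ⟨j, rfl, hj⟩ := getElem?_append_eq_some_iff.1 hg
    · exact ihφ hφ
    · rw [length_compile, ← add_assoc]
      obtain hψ | ⟨k, rfl, hk⟩ := getElem?_append_eq_some_iff.1 hj
      · exact ihψ hψ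
      · obtain ⟨rfl, rfl⟩ := getElem?_singleton_eq_some_iff.1 hk
        have := φ.size_pos
        have := ψ.size_pos
        rw [length_compile]
        constructor <;> simp only [TGate.ValidArg, cond_false] <;> omega

end Formula

namespace Formula

variable {α : Type*} {W : ℕ} {atom : α → TGate} {cell : ℕ} {φ : Fin W → Formula α}

/-- A block that evaluates a family of formulas. Every formula is given `cell` gates, the first of
which are padding, so that gate `cell * i + cell - 1` has the value of formula `i`. -/
def block (atom : α → TGate) (cell : ℕ) (φ : Fin W → Formula α) : List TGate :=
  (List.finRange W).flatMap fun i =>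
    List.replicate (cell - (φ i).size) (.const false) ++
      (φ i).compile atom (cell * i + (cell - (φ i).size))

theorem length_cell (hcell : ∀ i, (φ i).size ≤ cell) (i : Fin W) :
    (List.replicate (cell - (φ i).size) (TGate.const false) ++
      (φ i).compile atom (cell * i + (cell - (φ i).size))).length = cell := by
  rw [List.length_append, List.length_replicate, length_compile, Nat.sub_add_cancel (hcell i)]

theorem length_block (hcell : ∀ i, (φ i).size ≤ cell) :
    (block atom cell φ).length = cell * W := by
  rw [block, length_flatMap_of_length_eq fun i _ => length_cell hcell i, List.length_finRange]

theorem getD_values_block {n x a l : ℕ} {w : List Bool} {C : Circuit} {v : α → Bool}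
    (hC : C.WellFormed n)
    (hatom : ∀ i, ((atom i).inst x a l).value w (C.values w) = v i)
    (hcell : ∀ i, (φ i).size ≤ cell)
    (hφ : (block atom cell φ).map (TGate.inst x a l) <+: C.drop a) (i : Fin W) :
    (C.values w).getD (a + (cell * i + cell - 1)) false = (φ i).eval v := by
  have hi : (List.finRange W)[(i : ℕ)]? = some i := by simp
  have hprefix := isPrefix_drop_flatMap (fun i _ => length_cell (atom := atom) hcell i) hi
  have hprefix := isPrefix_drop_trans (List.map_drop ▸ hprefix.map (TGate.inst x a l)) hφ
  rw [List.map_append, append_isPrefix_drop, List.length_map, List.length_replicate,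
    add_assoc] at hprefix
  rw [← getD_values_compile hC hatom hprefix.2, add_assoc, Nat.sub_add_cancel (hcell i)]

theorem valid_block {I : Prop} {c m : ℕ} (hatom : ∀ m i, (atom i).Valid I c m)
    (hcell : ∀ i, (φ i).size ≤ cell) {g : TGate} (hg : (block atom cell φ)[m]? = some g) :
    g.Valid I c m := by
  obtain ⟨i, r, i', rfl, hi, hr⟩ := exists_of_getElem?_flatMap (fun i _ => length_cell hcell i) hg
  obtain rfl : i = i' := by
    obtain ⟨hlt, rfl⟩ := List.getElem?_eq_some_iff.1 hi
    simp
  obtain hpad | ⟨r, rfl, hcompile⟩ := getElem?_append_eq_some_iff.1 hr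
  · obtain rfl := List.eq_of_mem_replicate (List.mem_of_getElem? hpad)
    trivial
  · rw [List.length_replicate, ← add_assoc]
    exact valid_compile hatom hcompile

end Formula

/-! ### Circuits for iterated products in a finite monoid -/

/-- A scheme for balanced binary trees of blocks. Every block has `width` results, evaluated by the
formulas `leaf` from an input bit, `unit` from nothing, and `node` from the results of a left and
of a right child (`(false, i)` and `(true, i)` being their results number `i`), each of which takes
up `cell` gates; `out` evaluates the output of the circuit from the results of the root. -/
structure TreeScheme where
  width : ℕ
  cell : ℕ
  leaf : Fin width → Formula Unit
  unit : Fin width → Formula Empty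
  node : Fin width → Formula (Bool × Fin width)
  out : Formula (Fin width)
  size_leaf_le : ∀ i, (leaf i).size ≤ cell
  size_unit_le : ∀ i, (unit i).size ≤ cell
  size_node_le : ∀ i, (node i).size ≤ cell

namespace TreeScheme

variable (S : TreeScheme)

/-- The number of gates of a block. -/
def blk : ℕ := S.cell * S.width

/-- The gate of a block that has the result number `i`. -/
def pos (i : Fin S.width) : ℕ := S.cell * i + S.cell - 1

theorem pos_lt_blk (i : Fin S.width) : S.pos i < S.blk := by
  have hcell : 0 < S.cell := (S.unit i).size_pos.trans_le (S.size_unit_le i)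
  have hi : S.cell * (i + 1) ≤ S.blk := Nat.mul_le_mul_left _ i.isLt
  rw [Nat.mul_succ] at hi
  rw [pos]
  omega

/-- The gate that copies the result `s.2` of the left or right child. -/
def childGate (s : Bool × Fin S.width) : TGate :=
  .or (true, (bif s.1 then S.blk else 0) + S.pos s.2)
    (true, (bif s.1 then S.blk else 0) + S.pos s.2)

/-- The block of an input bit. -/
def leafT : List TGate := Formula.block (fun _ => .input) S.cell S.leaf

/-- The block of a leaf beyond the end of the input. -/
def unitT : List TGate := Formula.block Empty.elim S.cell S.unit

/-- The block of an inner node. -/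
def nodeT : List TGate := Formula.block S.childGate S.cell S.node

/-- The block of the output. -/
def outT : List TGate := S.out.compile (fun i => S.childGate (false, i)) 0

/-- The number of leaves of the tree for inputs of length `n`: a power of two beyond `n`. -/
def leaves (n : ℕ) : ℕ := 2 ^ (n + 1).size

theorem lt_leaves (n : ℕ) : n + 1 < leaves n := Nat.lt_size_self _

/-- The block number `j` of the circuit for inputs of length `n`. The leaves come first, and the
children of block `leaves n + c` are the blocks `2 * c` and `2 * c + 1`. -/
def template (n j : ℕ) : List TGate :=
  if j < n then S.leafT else if j < leaves n then S.unitT else S.nodeT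

/-- The gates of `T` as block number `j` of the circuit for inputs of length `n`. -/
def place (n j : ℕ) (T : List TGate) : List Gate :=
  T.map (TGate.inst j (S.blk * j) (S.blk * (2 * (j - leaves n))))

/-- The circuit for inputs of length `n`: the tree, whose root is the block `2 * leaves n - 2`,
followed by the output. -/
def circuit (n : ℕ) : Circuit :=
  ((List.range (2 * leaves n - 1)).flatMap fun j => S.place n j (S.template n j)) ++
    S.place n (2 * leaves n - 1) S.outT

variable {S} {n j m : ℕ}

theorem length_template : (S.template n j).length = S.blk := by
  rw [template]
  split_ifs
  exacts [Formula.length_block S.size_leaf_le, Formula.length_block S.size_unit_le,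
    Formula.length_block S.size_node_le]

theorem length_place_template : (S.place n j (S.template n j)).length = S.blk := by
  rw [place, List.length_map, length_template]

theorem length_outT : S.outT.length = S.out.size := Formula.length_compile _ _ _

theorem length_tree (N : ℕ) :
    ((List.range N).flatMap fun j => S.place n j (S.template n j)).length = S.blk * N := by
  rw [length_flatMap_of_length_eq fun _ _ => length_place_template, List.length_range]

theorem length_circuit : (S.circuit n).length = S.blk * (2 * leaves n - 1) + S.out.size := by
  rw [circuit, List.length_append, length_tree, place, List.length_map, length_outT]

theorem tree_isPrefix_drop_circuit :
    ((List.range (2 * leaves n - 1)).flatMap fun j => S.place n j (S.template n j)) <+: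
      (S.circuit n).drop 0 :=
  List.prefix_append _ _

theorem place_template_isPrefix (hj : j < 2 * leaves n - 1) :
    S.place n j (S.template n j) <+: (S.circuit n).drop (S.blk * j) := by
  have hprefix := isPrefix_drop_flatMap (f := fun j => S.place n j (S.template n j))
    (fun _ _ => length_place_template) (List.getElem?_range hj)
  exact Nat.zero_add (S.blk * j) ▸ isPrefix_drop_trans hprefix tree_isPrefix_drop_circuit

theorem place_outT_isPrefix :
    S.place n (2 * leaves n - 1) S.outT <+: (S.circuit n).drop (S.blk * (2 * leaves n - 1)) := by
  rw [circuit, ← length_tree, List.drop_left]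

/-! ### Well-formedness and depth -/

theorem valid_childGate {I : Prop} {c : ℕ} {s : Bool × Fin S.width}
    (hc : (bif s.1 then S.blk else 0) + S.blk ≤ c) : (S.childGate s).Valid I c m := by
  have h : TGate.ValidArg c m (true, (bif s.1 then S.blk else 0) + S.pos s.2) :=
    (Nat.add_lt_add_left (S.pos_lt_blk s.2) _).trans_le hc
  exact ⟨h, h⟩

theorem valid_template {g : TGate} (hg : (S.template n j)[m]? = some g) :
    g.Valid (j < n) (if j < leaves n then 0 else 2 * S.blk) m := by
  rw [template] at hg
  split_ifs at hg with hn hN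
  · exact Formula.valid_block (atom := fun _ => .input) (fun _ _ => hn) S.size_leaf_le hg
  · exact Formula.valid_block (fun _ => Empty.rec) S.size_unit_le hg
  · rw [if_neg hN]
    refine Formula.valid_block (fun _ s => valid_childGate ?_) S.size_node_le hg
    cases s.1 <;> simp only [cond_true, cond_false] <;> omega

theorem valid_outT {g : TGate} (hg : S.outT[m]? = some g) : g.Valid False S.blk m :=
  Nat.zero_add m ▸ Formula.valid_compile
    (fun _ i => valid_childGate (s := (false, i)) (Nat.zero_add _).le) hg

theorem getElem?_circuit {g : Gate} (hg : (S.circuit n)[m]? = some g) :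
    (∃ j r, j < 2 * leaves n - 1 ∧ m = S.blk * j + r ∧
      (S.place n j (S.template n j))[r]? = some g) ∨
    ∃ r, m = S.blk * (2 * leaves n - 1) + r ∧
      (S.place n (2 * leaves n - 1) S.outT)[r]? = some g := by
  obtain htree | ⟨r, rfl, hout⟩ := getElem?_append_eq_some_iff.1 hg
  · obtain ⟨j, r, j', rfl, hj, hr⟩ :=
      exists_of_getElem?_flatMap (fun _ _ => length_place_template) htree
    obtain ⟨hlt, rfl⟩ := List.getElem?_eq_some_iff.1 hj
    rw [List.length_range] at hlt
    exact .inl ⟨j, r, hlt, rfl, by rwa [List.getElem_range] at hr⟩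
  · exact .inr ⟨r, by rw [length_tree], hout⟩

theorem circuit_wellFormed (S : TreeScheme) (n : ℕ) : (S.circuit n).WellFormed n := by
  constructor
  · rw [← List.length_pos_iff, length_circuit]
    exact Nat.add_pos_right _ S.out.size_pos
  · intro m hm
    have hN := lt_leaves n
    obtain ⟨j, r, hj, hmr, hg⟩ | ⟨r, hmr, hg⟩ := getElem?_circuit (List.getElem?_eq_getElem hm) <;>
      rw [place, List.getElem?_map, Option.map_eq_some_iff] at hg <;>
      obtain ⟨g, hg, hinst⟩ := hg <;> rw [← hinst, hmr]
    · refine (valid_template hg).wellFormed_inst id ?_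
      split_ifs with h
      · simp [Nat.sub_eq_zero_of_le h.le]
      · calc S.blk * (2 * (j - leaves n)) + 2 * S.blk
          _ = S.blk * (2 * (j - leaves n) + 2) := by ring
          _ ≤ S.blk * j := Nat.mul_le_mul_left _ (by omega)
    · refine (valid_outT hg).wellFormed_inst False.elim ?_
      rw [← Nat.mul_succ]
      exact Nat.mul_le_mul_left _ (by omega)

theorem log_two_sub {j s : ℕ} (hj : leaves n ≤ j) (hj' : j < 2 * leaves n - 1) (hs : s < 2) :
    Nat.log 2 (2 * leaves n - 1 - (2 * (j - leaves n) + s)) =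
      Nat.log 2 (2 * leaves n - 1 - j) + 1 := by
  rw [Nat.log_of_one_lt_of_le one_lt_two (by omega)]
  congr 2
  omega

theorem getD_depths_block (hj : j < 2 * leaves n - 1) (hm : m < S.blk) :
    (S.circuit n).depths.getD (S.blk * j + m) 0 ≤
      S.blk * ((n + 1).size - Nat.log 2 (2 * leaves n - 1 - j)) + m + 1 := by
  induction j using Nat.strong_induction_on generalizing m with
  | _ j ih =>
    refine TGate.depth_le_of_valid (circuit_wellFormed S n) (place_template_isPrefix hj)
      (fun _ _ => valid_template) (fun i hi => ?_) (by rwa [length_template])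
    split_ifs at hi with h
    · exact absurd hi (Nat.not_lt_zero i)
    obtain ⟨s, r, hs, hr, rfl⟩ : ∃ s r, s < 2 ∧ r < S.blk ∧ i = S.blk * s + r :=
      ⟨i / S.blk, i % S.blk, Nat.div_lt_of_lt_mul (mul_comm 2 _ ▸ hi),
        Nat.mod_lt _ (by omega), (Nat.div_add_mod _ _).symm⟩
    have hlog := log_two_sub (not_lt.1 h) hj hs
    have hle : Nat.log 2 (2 * leaves n - 1 - (2 * (j - leaves n) + s)) ≤ (n + 1).size :=
      Nat.le_of_lt_succ (Nat.log_lt_of_lt_pow (by omega)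
        (by rw [pow_succ, ← leaves]; have := lt_leaves n; omega))
    have hdepth := ih (2 * (j - leaves n) + s) (by omega) (by omega) hr
    rw [hlog] at hdepth hle
    rw [← add_assoc, ← mul_add]
    refine hdepth.trans ?_
    calc S.blk * ((n + 1).size - (Nat.log 2 (2 * leaves n - 1 - j) + 1)) + r + 1
      _ ≤ S.blk * ((n + 1).size - (Nat.log 2 (2 * leaves n - 1 - j) + 1)) + S.blk := by omega
      _ = S.blk * ((n + 1).size - (Nat.log 2 (2 * leaves n - 1 - j) + 1) + 1) := by ring
      _ = _ := by congr 1; omega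

theorem depth_circuit_le (S : TreeScheme) (n : ℕ) :
    (S.circuit n).depth ≤ S.blk * ((n + 1).size + 1) + S.out.size := by
  have getD_depths_tree {j r : ℕ} (hj : j < 2 * leaves n - 1) (hr : r < S.blk) :
      (S.circuit n).depths.getD (S.blk * j + r) 0 ≤ S.blk * ((n + 1).size + 1) := by
    refine (getD_depths_block hj hr).trans ?_
    rw [Nat.mul_succ, add_assoc]
    exact Nat.add_le_add (Nat.mul_le_mul_left _ (Nat.sub_le _ _)) hr
  have hN := lt_leaves n
  refine Circuit.depth_le fun m hm => ?_
  obtain ⟨j, r, hj, rfl, hg⟩ | ⟨r, rfl, hg⟩ := getElem?_circuit (List.getElem?_eq_getElem hm)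
  · have hr := (List.getElem?_eq_some_iff.1 hg).1
    rw [length_place_template] at hr
    exact (getD_depths_tree hj hr).trans (Nat.le_add_right _ _)
  · have hr := (List.getElem?_eq_some_iff.1 hg).1
    rw [place, List.length_map] at hr
    have hdepth := TGate.depth_le_of_valid (circuit_wellFormed S n) place_outT_isPrefix
      (fun _ _ => valid_outT)
      (fun i hi => getD_depths_tree (by omega) hi) hr
    rw [length_outT] at hr
    omega

/-! ### Values -/

/-- The scheme `S` evaluates the products of the elements `φ b` of `M`, for the bits `b` of the
input, and accepts those in `A`; the results of a block represent an element of `M` by `enc`. -/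
structure Computes {M : Type*} [Monoid M] (S : TreeScheme) (φ : Bool → M) (A : Set M)
    (enc : M → Fin S.width → Bool) : Prop where
  eval_leaf : ∀ b i, (S.leaf i).eval (fun _ => b) = enc (φ b) i
  eval_unit : ∀ i, (S.unit i).eval Empty.elim = enc 1 i
  eval_node : ∀ a b i, (S.node i).eval (fun s => enc (bif s.1 then b else a) s.2) = enc (a * b) i
  eval_out : ∀ a, S.out.eval (enc a) = true ↔ a ∈ A

theorem value_childGate {x a l : ℕ} {w v : List Bool} (s : Bool × Fin S.width) :
    ((S.childGate s).inst x a l).value w v =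
      v.getD (l + ((bif s.1 then S.blk else 0) + S.pos s.2)) false :=
  Bool.or_self _

section Monoid

variable {M : Type*} [Monoid M] {φ : Bool → M} {A : Set M} {enc : M → Fin S.width → Bool}
  {w : List Bool}

theorem Computes.getD_values_leaf (h : S.Computes φ A enc) {j : ℕ} (hj : j < leaves w.length)
    (i : Fin S.width) :
    ((S.circuit w.length).values w).getD (S.blk * j + S.pos i) false =
      enc (((w.drop j).take 1).map φ).prod i := by
  have hplace := place_template_isPrefix (S := S) (n := w.length) (j := j) (by omega)
  have hC := circuit_wellFormed S w.length
  rw [template] at hplace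
  split_ifs at hplace with hn
  · have hatom : ∀ _ : Unit, (Gate.input j).value w ((S.circuit w.length).values w) = w[j] :=
      fun _ => List.getD_eq_getElem _ _ hn
    rw [List.take_one_drop_eq_of_lt_length hn, List.map_singleton, List.prod_singleton,
      ← h.eval_leaf]
    exact Formula.getD_values_block hC hatom S.size_leaf_le hplace i
  · rw [List.drop_eq_nil_of_le (not_lt.1 hn), List.take_nil, List.map_nil, List.prod_nil,
      ← h.eval_unit]
    exact Formula.getD_values_block hC (fun e => e.elim) S.size_unit_le hplace i

theorem Computes.getD_values_node (h : S.Computes φ A enc) {j : ℕ} (hj : leaves n ≤ j)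
    (hj' : j < 2 * leaves n - 1) {a b : M}
    (ha : ∀ i, ((S.circuit n).values w).getD (S.blk * (2 * (j - leaves n)) + S.pos i) false =
      enc a i)
    (hb : ∀ i, ((S.circuit n).values w).getD (S.blk * (2 * (j - leaves n) + 1) + S.pos i) false =
      enc b i) (i : Fin S.width) :
    ((S.circuit n).values w).getD (S.blk * j + S.pos i) false = enc (a * b) i := by
  have hplace := place_template_isPrefix (S := S) hj'
  have hN := lt_leaves n
  rw [template, if_neg (by omega), if_neg (by omega)] at hplace
  rw [← h.eval_node]
  refine Formula.getD_values_block (circuit_wellFormed S n) (fun s => ?_) S.size_node_le hplace i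
  rw [value_childGate]
  obtain ⟨_ | _, t⟩ := s
  · rw [cond_false, cond_false, Nat.zero_add]
    exact ha t
  · rw [cond_true, cond_true, ← add_assoc, ← Nat.mul_succ]
    exact hb t

theorem Computes.getD_values_level (h : S.Computes φ A enc) {l K i : ℕ}
    (hK : K + l = (w.length + 1).size) (hi : i < 2 ^ K) (t : Fin S.width) :
    ((S.circuit w.length).values w).getD
        (S.blk * (2 * leaves w.length - 2 * 2 ^ K + i) + S.pos t) false =
      enc (((w.drop (i * 2 ^ l)).take (2 ^ l)).map φ).prod t := by
  have hN : leaves w.length = 2 ^ K * 2 ^ l := by rw [← pow_add, hK, leaves]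
  induction l generalizing K i t with
  | zero =>
    rw [pow_zero, mul_one] at hN ⊢
    rw [← hN, Nat.sub_self, Nat.zero_add]
    exact h.getD_values_leaf (by omega) t
  | succ l ih =>
    have : 2 ^ (K + 1) = 2 * 2 ^ K := pow_succ' 2 K
    have hle : 2 * 2 ^ K ≤ leaves w.length := by
      rw [hN, mul_comm 2]
      exact Nat.mul_le_mul_left _ (by rw [pow_succ]; have := Nat.one_le_two_pow (n := l); omega)
    have hchild (c : ℕ) : 2 * (2 * leaves w.length - 2 * 2 ^ K + i - leaves w.length) + c =
        2 * leaves w.length - 2 * 2 ^ (K + 1) + (2 * i + c) := by omega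
    have ih' {c : ℕ} (hc : c < 2) (s : Fin S.width) :=
      ih (K := K + 1) (i := 2 * i + c) (by omega) (by omega) s (by rw [hN]; ring)
    rw [pow_succ, mul_two, List.take_add, List.map_append, List.prod_append, List.drop_drop]
    refine h.getD_values_node (by omega) (by omega) (fun s => ?_) (fun s => ?_) t
    · rw [← Nat.add_zero (2 * _), hchild, ih' two_pos,
        show (2 * i + 0) * 2 ^ l = i * (2 ^ l + 2 ^ l) by ring]
    · rw [hchild, ih' one_lt_two,
        show (2 * i + 1) * 2 ^ l = i * (2 ^ l + 2 ^ l) + 2 ^ l by ring]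

theorem Computes.eval_circuit (h : S.Computes φ A enc) (w : List Bool) :
    (S.circuit w.length).eval w = true ↔ (w.map φ).prod ∈ A := by
  have hN := lt_leaves w.length
  have hroot := h.getD_values_level (w := w) (K := 0) (i := 0) (Nat.zero_add _) one_pos
  rw [zero_mul, List.drop_zero, ← leaves, List.take_of_length_le (by omega)] at hroot
  have hatom (i : Fin S.width) : ((S.childGate (false, i)).inst (2 * leaves w.length - 1)
      (S.blk * (2 * leaves w.length - 1))
      (S.blk * (2 * (2 * leaves w.length - 1 - leaves w.length)))).value w
        ((S.circuit w.length).values w) = enc (w.map φ).prod i := by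
    rw [value_childGate, ← hroot, cond_false, Nat.zero_add]
    congr 3
    omega
  have hout :=
    Formula.getD_values_compile (o := 0) (circuit_wellFormed S _) hatom place_outT_isPrefix
  rw [← h.eval_out, ← hout, Circuit.eval_eq_getD_values, length_circuit, Nat.zero_add,
    Nat.add_sub_assoc S.out.size_pos]

end Monoid

theorem exists_computes {M : Type*} [Monoid M] [Finite M] (φ : Bool → M) (A : Set M) :
    ∃ (S : TreeScheme) (enc : M → Fin S.width → Bool), S.Computes φ A enc := by
  classical
  let e := Finite.equivFin M
  let enc (a : M) (i : Fin (Nat.card M)) : Bool := decide (e a = i)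
  let dec : (Fin (Nat.card M) → Bool) → M := Function.invFun enc
  have dec_enc : Function.LeftInverse dec enc := by
    refine Function.leftInverse_invFun fun a b hab => e.injective ?_
    simpa [enc, eq_comm] using congrFun hab (e a)
  choose leaf hleaf using fun i => Formula.exists_eval_eq fun v : Unit → Bool => enc (φ (v ())) i
  choose unit hunit using fun i => Formula.exists_eval_eq fun _ : Empty → Bool => enc 1 i
  choose node hnode using fun i => Formula.exists_eval_eq
    fun v : Bool × Fin (Nat.card M) → Bool =>
      enc (dec (fun t => v (false, t)) * dec (fun t => v (true, t))) i
  obtain ⟨out, hout⟩ := Formula.exists_eval_eq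
    fun v : Fin (Nat.card M) → Bool => decide (dec v ∈ A)
  obtain ⟨c₁, hc₁⟩ := Finite.exists_le fun i => (leaf i).size
  obtain ⟨c₂, hc₂⟩ := Finite.exists_le fun i => (unit i).size
  obtain ⟨c₃, hc₃⟩ := Finite.exists_le fun i => (node i).size
  refine ⟨⟨Nat.card M, c₁ + c₂ + c₃, leaf, unit, node, out, fun i => (hc₁ i).trans (by omega),
    fun i => (hc₂ i).trans (by omega), fun i => (hc₃ i).trans (by omega)⟩, enc, ?_, ?_, ?_, ?_⟩
  · exact fun b i => hleaf i _
  · exact fun i => hunit i _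
  · intro a b i
    refine (hnode i _).trans ?_
    simp only [cond_false, cond_true]
    rw [dec_enc, dec_enc]
  · intro a
    rw [hout, dec_enc, decide_eq_true_iff]

end TreeScheme

end Circ

/-! ### Register programs -/

namespace TM

/-- Programs over `k` registers that hold natural numbers. `loop r P` runs `P` as long as register
`r` is not zero, decrementing it before each run. The register `none`, which cannot be incremented,
counts the cells of the input tape that are to the right of the input head. -/
inductive Prog (k : ℕ) : Type
  | skip
  | inc (r : Fin k)
  | pred (r : Option (Fin k))
  | emit (b : Bool)
  | seq (P Q : Prog k)
  | loop (r : Option (Fin k)) (P : Prog k)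

/-- Big-step semantics of programs: the initial and the final registers and the output, where
increments do not lead beyond `B`. -/
inductive Exec {k : ℕ} (B : ℕ) :
    Prog k → (Option (Fin k) → ℕ) → (Option (Fin k) → ℕ) → List Bool → Prop
  | skip (ρ) : Exec B .skip ρ ρ []
  | inc (r ρ) : ρ (some r) + 1 ≤ B →
      Exec B (.inc r) ρ (Function.update ρ (some r) (ρ (some r) + 1)) []
  | pred (r ρ) : Exec B (.pred r) ρ (Function.update ρ r (ρ r - 1)) []
  | emit (b ρ) : Exec B (.emit b) ρ ρ [b]
  | seq {P Q ρ ρ' ρ'' o o'} : Exec B P ρ ρ' o → Exec B Q ρ' ρ'' o' →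
      Exec B (.seq P Q) ρ ρ'' (o ++ o')
  | loop_zero {r P ρ} : ρ r = 0 → Exec B (.loop r P) ρ ρ []
  | loop_succ {r P ρ ρ' ρ'' o o'} : ρ r ≠ 0 → Exec B P (Function.update ρ r (ρ r - 1)) ρ' o →
      Exec B (.loop r P) ρ' ρ'' o' → Exec B (.loop r P) ρ ρ'' (o ++ o')

/-! ### Binary counters on a tape -/

/-- Symbols of the work tapes: blank or a binary digit. -/
abbrev Sym : Type := Option Bool

/-- The tape with the digits `u` from cell `1` on. Cell `0` stays blank, so that the head recognizes
it when it moves to the left. -/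
def tapeOf (u : List Bool) : ℕ → Sym
  | 0 => none
  | i + 1 => u[i]?

theorem tapeOf_nil : tapeOf [] = fun _ => none := by
  funext i
  cases i <;> rfl

theorem tapeOf_append_cons (u v : List Bool) (b : Bool) :
    tapeOf (u ++ b :: v) (u.length + 1) = some b := by
  simp [tapeOf]

theorem tapeOf_length_add_one (u : List Bool) : tapeOf u (u.length + 1) = none :=
  List.getElem?_eq_none le_rfl

theorem update_tapeOf_append_cons (u v : List Bool) (b b' : Bool) :
    Function.update (tapeOf (u ++ b :: v)) (u.length + 1) (some b') = tapeOf (u ++ b' :: v) := by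
  refine Function.update_eq_iff.2 ⟨(tapeOf_append_cons u v b').symm, fun i hi => ?_⟩
  cases i with
  | zero => rfl
  | succ i =>
    have : i ≠ u.length := fun h => hi (congrArg (· + 1) h)
    simp only [tapeOf, List.getElem?_append, List.getElem?_cons]
    grind

theorem update_tapeOf_length_add_one (u : List Bool) (b : Bool) :
    Function.update (tapeOf u) (u.length + 1) (some b) = tapeOf (u ++ [b]) := by
  refine Function.update_eq_iff.2 ⟨(tapeOf_append_cons u [] b).symm, fun i hi => ?_⟩
  cases i with
  | zero => rfl
  | succ i =>
    have : i ≠ u.length := fun h => hi (congrArg (· + 1) h)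
    simp only [tapeOf, List.getElem?_append, List.getElem?_cons]
    grind

/-- The number with the binary digits `u`, least significant digit first. -/
def binVal (u : List Bool) : ℕ := u.foldr Nat.bit 0

/-- Increment of a binary number. -/
def binInc : List Bool → List Bool
  | [] => [true]
  | false :: u => true :: u
  | true :: u => false :: binInc u

/-- Decrement of a binary number, if it is not zero; the number of digits is preserved. -/
def binDec : List Bool → Option (List Bool)
  | [] => none
  | true :: u => some (false :: u)
  | false :: u => (binDec u).map (true :: ·)

theorem binVal_cons (b : Bool) (u : List Bool) : binVal (b :: u) = 2 * binVal u + b.toNat :=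
  Nat.bit_val b (binVal u)

theorem binVal_binInc (u : List Bool) : binVal (binInc u) = binVal u + 1 := by
  induction u with
  | nil => rfl
  | cons b u ih => cases b <;> simp [binInc, binVal_cons, ih, mul_add]

theorem length_binInc (u : List Bool) :
    (binInc u).length = u.length ∨
      (binInc u).length = u.length + 1 ∧ binVal u + 1 = 2 ^ u.length := by
  induction u with
  | nil => exact .inr ⟨rfl, rfl⟩
  | cons b u ih =>
    cases b with
    | false => exact .inl rfl
    | true =>
      refine ih.imp (congrArg (· + 1)) fun h => ⟨congrArg (· + 1) h.1, ?_⟩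
      rw [binVal_cons, List.length_cons, pow_succ, ← h.2, Bool.toNat_true]
      ring

theorem binDec_eq_some {u v : List Bool} (h : binDec u = some v) :
    binVal u = binVal v + 1 ∧ v.length = u.length := by
  induction u generalizing v with
  | nil => cases h
  | cons b u ih =>
    cases b with
    | false =>
      obtain ⟨v, hv, rfl⟩ := Option.map_eq_some_iff.1 h
      obtain ⟨hval, hlen⟩ := ih hv
      refine ⟨?_, congrArg (· + 1) hlen⟩
      rw [binVal_cons, binVal_cons, hval, Bool.toNat_false, Bool.toNat_true]
      ring
    | true =>
      cases h
      exact ⟨by simp [binVal_cons], rfl⟩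

theorem eq_replicate_of_binDec_eq_none {u : List Bool} (h : binDec u = none) :
    u = List.replicate u.length false := by
  induction u with
  | nil => rfl
  | cons b u ih =>
    cases b with
    | false => exact congrArg (false :: ·) (ih (Option.map_eq_none_iff.1 h))
    | true => cases h

theorem binVal_replicate_false (m : ℕ) : binVal (List.replicate m false) = 0 := by
  induction m with
  | zero => rfl
  | succ m ih => rw [List.replicate_succ, binVal_cons, ih, Bool.toNat_false]

/-- What the head of a binary counter is doing: `up` increments and `down` decrements from the
current digit on, `undo` reverts a decrement of zero, and `back` only returns to cell `0`. -/
inductive Phase : Type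
  | up
  | down
  | undo
  | back

instance : Finite Phase :=
  Finite.of_injective (β := Fin 4) (fun | .up => 0 | .down => 1 | .undo => 2 | .back => 3)
    (by intro a b; cases a <;> cases b <;> simp)

/-- One step of the head of a binary counter: the next phase, or the end of the operation and
whether it succeeded, what is written, and the move. -/
def Phase.act : Phase → Sym → (Phase ⊕ Bool) × Sym × Move
  | .up, some true => (.inl .up, some false, .right)
  | .up, _ => (.inl .back, some true, .left)
  | .down, some false => (.inl .down, some true, .right)
  | .down, some true => (.inl .back, some false, .left)
  | .down, none => (.inl .undo, none, .left)
  | .undo, some _ => (.inl .undo, some false, .left)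
  | .undo, none => (.inr false, none, .stay)
  | .back, some b => (.inl .back, some b, .left)
  | .back, none => (.inr true, none, .stay)

/-- In the phase `κ`, from the tape `σ` and cell `h`, the head of a binary counter reaches cell `0`
within the first `s` cells and ends the operation with the answer `b` and the tape `τ`. -/
inductive CounterRun (s : ℕ) (b : Bool) (τ : ℕ → Sym) : Phase → (ℕ → Sym) → ℕ → Prop
  | halt {κ} : 0 < s → κ.act (τ 0) = (.inr b, τ 0, .stay) → CounterRun s b τ κ τ 0
  | step {κ κ' σ h c mv} : h < s → κ.act (σ h) = (.inl κ', c, mv) →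
      CounterRun s b τ κ' (Function.update σ h c) (mv.apply h) → CounterRun s b τ κ σ h

namespace CounterRun

variable {s : ℕ}

theorem back {u : List Bool} {h : ℕ} (hu : h ≤ u.length) (hs : h < s) :
    CounterRun s true (tapeOf u) .back (tapeOf u) h := by
  induction h with
  | zero => exact .halt hs rfl
  | succ h ih =>
    have hdigit : tapeOf u (h + 1) = some u[h] := List.getElem?_eq_getElem hu
    refine .step hs (by rw [hdigit]; rfl) ?_
    rw [← hdigit, Function.update_eq_self]
    exact ih (by omega) (by omega)

theorem undo (u v : List Bool) (hs : u.length < s) :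
    CounterRun s false (tapeOf (List.replicate u.length false ++ v)) .undo (tapeOf (u ++ v))
      u.length := by
  induction u using List.reverseRecOn generalizing v with
  | nil => exact .halt hs rfl
  | append_singleton u b ih =>
    rw [List.append_assoc, List.singleton_append, List.length_append, List.length_singleton] at *
    refine .step hs (by rw [tapeOf_append_cons]; rfl) ?_
    rw [update_tapeOf_append_cons, List.replicate_succ', List.append_assoc]
    exact ih (false :: v) (by omega)

theorem up (u v : List Bool) (hs : u.length + v.length + 1 < s) :
    CounterRun s true (tapeOf (u ++ binInc v)) .up (tapeOf (u ++ v)) (u.length + 1) := by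
  induction v generalizing u with
  | nil =>
    rw [List.append_nil]
    refine .step hs (by rw [tapeOf_length_add_one]; rfl) ?_
    rw [update_tapeOf_length_add_one]
    exact back (List.length_append ▸ Nat.le_add_right _ _) (show u.length < s by omega)
  | cons b v ih =>
    cases b with
    | false =>
      refine .step (by omega) (by rw [tapeOf_append_cons]; rfl) ?_
      rw [update_tapeOf_append_cons]
      exact back (List.length_append ▸ Nat.le_add_right _ _) (show u.length < s by omega)
    | true =>
      refine .step (by omega) (by rw [tapeOf_append_cons]; rfl) ?_
      rw [update_tapeOf_append_cons]
      have := ih (u ++ [false]) (by grind)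
      simpa [Move.apply, binInc] using this

theorem down_of_binDec_eq_some (u : List Bool) {v v' : List Bool} (hv : binDec v = some v')
    (hs : u.length + v.length + 1 < s) :
    CounterRun s true (tapeOf (u ++ v')) .down (tapeOf (u ++ v)) (u.length + 1) := by
  induction v generalizing u v' with
  | nil => cases hv
  | cons b v ih =>
    cases b with
    | true =>
      cases hv
      refine .step (by omega) (by rw [tapeOf_append_cons]; rfl) ?_
      rw [update_tapeOf_append_cons]
      exact back (List.length_append ▸ Nat.le_add_right _ _) (show u.length < s by omega)
    | false =>
      obtain ⟨w, hw, rfl⟩ := Option.map_eq_some_iff.1 hv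
      refine .step (by omega) (by rw [tapeOf_append_cons]; rfl) ?_
      rw [update_tapeOf_append_cons]
      have := ih (u ++ [true]) hw (by grind)
      simpa [Move.apply] using this

theorem down_of_binDec_eq_none (u : List Bool) {v : List Bool} (hv : binDec v = none)
    (hs : u.length + v.length + 1 < s) :
    CounterRun s false (tapeOf (List.replicate (u.length + v.length) false)) .down
      (tapeOf (u ++ v)) (u.length + 1) := by
  induction v generalizing u with
  | nil =>
    rw [List.append_nil]
    refine .step (by omega) (by rw [tapeOf_length_add_one]; rfl) ?_
    rw [← tapeOf_length_add_one u, Function.update_eq_self]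
    have := undo (s := s) u [] (by grind)
    simpa [Move.apply] using this
  | cons b v ih =>
    cases b with
    | true => cases hv
    | false =>
      refine .step (by omega) (by rw [tapeOf_append_cons]; rfl) ?_
      rw [update_tapeOf_append_cons]
      have := ih (u ++ [true]) (Option.map_eq_none_iff.1 hv) (by grind)
      simpa [Move.apply, add_assoc, add_comm 1] using this

theorem exists_down (u : List Bool) (hs : u.length + 1 < s) :
    ∃ v, CounterRun s (decide (binVal u ≠ 0)) (tapeOf v) .down (tapeOf u) 1 ∧
      binVal v = binVal u - 1 ∧ v.length = u.length := by
  cases h : binDec u with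
  | none =>
    have hu : binVal u = 0 := by rw [eq_replicate_of_binDec_eq_none h, binVal_replicate_false]
    have hrun := down_of_binDec_eq_none (s := s) [] h (by simpa using hs)
    rw [List.length_nil, Nat.zero_add] at hrun
    refine ⟨List.replicate u.length false, ?_, ?_, List.length_replicate⟩
    · simpa [hu] using hrun
    · rw [binVal_replicate_false, hu]
  | some v =>
    obtain ⟨hval, hlen⟩ := binDec_eq_some h
    have hrun := down_of_binDec_eq_some (s := s) [] h (by simpa using hs)
    exact ⟨v, by simpa [hval] using hrun, by omega, hlen⟩

end CounterRun

end TM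

/-! ### Simulation of register programs by Turing machines -/

namespace TM

variable {k : ℕ}

/-- The programs that remain to be run after the first one of a list has tested its register, with
the answer `b` to the question whether it was not zero. -/
def resume : Bool → List (Prog k) → List (Prog k)
  | true, .loop r P :: l => P :: .loop r P :: l
  | _, l => l.tail

/-- The lists of programs that can remain to be run when `P` is run before `l`. -/
def continuations : Prog k → List (Prog k) → Set (List (Prog k))
  | .seq P Q, l => {.seq P Q :: l} ∪ continuations P (Q :: l) ∪ continuations Q l
  | .loop r P, l => {.loop r P :: l, l} ∪ continuations P (.loop r P :: l)
  | P, l => {P :: l, l}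

theorem finite_continuations (P : Prog k) (l : List (Prog k)) : (continuations P l).Finite := by
  induction P generalizing l with
  | seq P Q ihP ihQ => exact ((Set.finite_singleton _).union (ihP _)).union (ihQ _)
  | loop r P ih => exact (Set.toFinite _).union (ih _)
  | _ => simp [continuations]

theorem cons_mem_continuations (P : Prog k) (l : List (Prog k)) : P :: l ∈ continuations P l := by
  cases P <;> simp [continuations]

theorem mem_continuations (P : Prog k) (l : List (Prog k)) : l ∈ continuations P l := by
  induction P generalizing l <;> simp [continuations, *]

/-- The list `l` as an element of the finite set of those that occur in a run of `P`. -/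
noncomputable def clip (P : Prog k) (l : List (Prog k)) : {l // l ∈ continuations P []} := by
  classical
  exact if h : l ∈ continuations P [] then ⟨l, h⟩ else ⟨[], mem_continuations P []⟩

theorem coe_clip {P : Prog k} {l : List (Prog k)} (h : l ∈ continuations P []) :
    (clip P l : List (Prog k)) = l := by
  simp [clip, h]

/-- What a transition prescribes: the programs that remain to be run together with the counter in
operation (if any) and its phase, the move of the input head, the actions on the work tapes and the
output. -/
abbrev Action (k : ℕ) : Type :=
  (List (Prog k) × Option (Phase × Fin k)) × Move × (Fin k → Sym × Move) × Option Bool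

/-- The action that changes nothing on the work tapes, which contain the symbols `syms`. -/
def idle (syms : Fin k → Sym) : Fin k → Sym × Move := fun t => (syms t, .stay)

/-- The action that starts the operation `κ` on the counter `r`. -/
def startPhase (κ : Phase) (r : Fin k) (l : List (Prog k)) (syms : Fin k → Sym) : Action k :=
  ((l, some (κ, r)), .stay, Function.update (idle syms) r (syms r, .right), none)

/-- The action that starts to test and to decrement register `r`. -/
def test (l : List (Prog k)) (cell : Cell) (syms : Fin k → Sym) : Option (Fin k) → Action k
  | some r => startPhase .down r l syms
  | none => match cell with
    | .rightEnd => ((resume false l, none), .stay, idle syms, none)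
    | _ => ((resume true l, none), .right, idle syms, none)

/-- The action when no counter is in operation. -/
def dispatch (cell : Cell) (syms : Fin k → Sym) : List (Prog k) → Option (Action k)
  | [] => none
  | .skip :: l => some ((l, none), .stay, idle syms, none)
  | .inc r :: l => some (startPhase .up r (.inc r :: l) syms)
  | .pred r :: l => some (test (.pred r :: l) cell syms r)
  | .emit b :: l => some ((l, none), .stay, idle syms, some b)
  | .seq P Q :: l => some ((P :: Q :: l, none), .stay, idle syms, none)
  | .loop r P :: l => some (test (.loop r P :: l) cell syms r)

/-- The transition function of the machine of a program, on unrestricted lists of programs. -/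
def transition (l : List (Prog k)) (cell : Cell) (syms : Fin k → Sym) :
    Option (Phase × Fin k) → Option (Action k)
  | none => dispatch cell syms l
  | some (κ, r) => match κ.act (syms r) with
    | (.inl κ', a) => some ((l, some (κ', r)), .stay, Function.update (idle syms) r a, none)
    | (.inr b, a) => some ((resume b l, none), .stay, Function.update (idle syms) r a, none)

/-- The Turing machine that runs a program, with each register other than `none` stored as a binary
counter on a work tape of its own. -/
noncomputable def Prog.machine (P : Prog k) : Machine where
  State := {l // l ∈ continuations P []} × Option (Phase × Fin k)
  finiteState := by
    have := (finite_continuations P []).to_subtype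
    infer_instance
  Symbol := Sym
  finiteSymbol := inferInstance
  tapes := k
  start := (clip P [P], none)
  blank := none
  δ q cell syms := (transition q.1 cell syms q.2).map fun a => ((clip P a.1.1, a.1.2), a.2)

/-- Configurations of the machine of a program. -/
noncomputable def Prog.conf (P : Prog k) (l : List (Prog k)) (ph : Option (Phase × Fin k)) (i : ℕ)
    (T : Fin k → ℕ → Sym) (hd : Fin k → ℕ) (out : List Bool) : P.machine.Cfg where
  state := (clip P l, ph)
  inputHead := i
  tape := T
  head := hd
  output := out

/-- A sequence of steps in which all work heads stay in the first `s` cells, except possibly in the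
last configuration. -/
def Machine.RunIn (M : Machine) (w : List Bool) (s : ℕ) : M.Cfg → M.Cfg → Prop :=
  Relation.ReflTransGen fun c c' => (∀ t, c.head t < s) ∧ M.step w c = some c'

theorem Machine.RunIn.reaches {M : Machine} {w : List Bool} {s : ℕ} {c c' : M.Cfg}
    (h : M.RunIn w s c c') : StateTransition.Reaches (M.step w) c c' :=
  Relation.ReflTransGen.mono (fun _ _ h => h.2) _ _ h

theorem Machine.RunIn.head_lt {M : Machine} {w : List Bool} {s : ℕ} {c c' d : M.Cfg}
    (h : M.RunIn w s c c') (hc' : ∀ t, c'.head t < s) (hhalt : M.step w c' = none)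
    (hd : StateTransition.Reaches (M.step w) c d) : ∀ t, d.head t < s := by
  induction h using Relation.ReflTransGen.head_induction_on with
  | refl =>
    obtain rfl | ⟨e, he, -⟩ := Relation.ReflTransGen.cases_head hd
    · exact hc'
    · cases hhalt.symm.trans he
  | head hstep _ ih =>
    obtain rfl | ⟨e, he, hed⟩ := Relation.ReflTransGen.cases_head hd
    · exact hstep.1
    · cases hstep.2.symm.trans he
      exact ih hed

section Simulation

variable {P : Prog k} {w : List Bool} {s : ℕ} {l l' : List (Prog k)} {r : Fin k} {i : ℕ}
  {T : Fin k → ℕ → Sym} {out : List Bool}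

theorem step_conf (hl : l ∈ continuations P []) {ph ph' : Option (Phase × Fin k)}
    {hd : Fin k → ℕ} {mv : Move} {act : Fin k → Sym × Move} {o : Option Bool}
    (h : transition l (inputCell w i) (fun t => T t (hd t)) ph = some ((l', ph'), mv, act, o)) :
    P.machine.step w (P.conf l ph i T hd out) =
      some (P.conf l' ph' (min (mv.apply i) (w.length + 1))
        (fun t => Function.update (T t) (hd t) (act t).1) (fun t => (act t).2.apply (hd t))
        (out ++ o.toList)) := by
  simp only [Machine.step, Prog.machine, Prog.conf, coe_clip hl, h, Option.map_some]

theorem runIn_idle (hs : 0 < s) (hl : l ∈ continuations P []) {mv : Move} {o : Option Bool}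
    (h : transition l (inputCell w i) (fun t => T t 0) none =
      some ((l', none), mv, idle fun t => T t 0, o)) :
    P.machine.RunIn w s (P.conf l none i T 0 out)
      (P.conf l' none (min (mv.apply i) (w.length + 1)) T 0 (out ++ o.toList)) := by
  refine .single ⟨fun _ => hs, (step_conf hl h).trans ?_⟩
  simp only [idle, Function.update_eq_self]
  rfl

theorem step_conf_update (hl : l ∈ continuations P []) (hi : i ≤ w.length + 1)
    {ph ph' : Option (Phase × Fin k)} {h : ℕ} {a : Sym × Move}
    (ht : ∀ syms, syms r = T r h → transition l (inputCell w i) syms ph =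
      some ((l', ph'), .stay, Function.update (idle syms) r a, none)) :
    P.machine.step w (P.conf l ph i T (Pi.single r h) out) =
      some (P.conf l' ph' i (Function.update T r (Function.update (T r) h a.1))
        (Pi.single r (a.2.apply h)) out) := by
  rw [step_conf hl (ht _ (by rw [Pi.single_eq_same])), Move.apply, min_eq_left hi,
    Option.toList_none, List.append_nil]
  congr 2 <;> funext t <;> obtain rfl | h := eq_or_ne t r <;> simp [idle, Move.apply, *]

theorem single_lt {h : ℕ} (hs : h < s) (t : Fin k) : (Pi.single r h : Fin k → ℕ) t < s := by
  rw [Pi.single_apply]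
  split_ifs <;> omega

theorem CounterRun.runIn {b : Bool} {σ τ : ℕ → Sym} {κ : Phase} {h : ℕ}
    (hrun : CounterRun s b τ κ σ h) (hT : T r = σ) (hi : i ≤ w.length + 1)
    (hl : l ∈ continuations P []) :
    P.machine.RunIn w s (P.conf l (some (κ, r)) i T (Pi.single r h) out)
      (P.conf (resume b l) none i (Function.update T r τ) 0 out) := by
  induction hrun generalizing T with
  | halt hs hact =>
    refine .single ⟨single_lt hs, (step_conf_update (l' := resume b l) (ph' := none)
      (a := (τ 0, .stay)) hl hi ?_).trans ?_⟩
    · intro syms hsyms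
      simp only [transition, hsyms, hT, hact]
    · rw [hT, Function.update_eq_self, Move.apply, Pi.single_zero]
  | @step κ κ' σ h c mv hs hact _ ih =>
    refine .head ⟨single_lt hs, step_conf_update (l' := l) (ph' := some (κ', r)) (a := (c, mv))
      hl hi ?_⟩ ?_
    · intro syms hsyms
      simp only [transition, hsyms, hT, hact]
    · have := ih (T := Function.update T r (Function.update (T r) h c)) (by simp [hT])
      rwa [Function.update_idem] at this

/-- The input head and the work tapes hold the registers `ρ`, all but `none` at most `B`. -/
def Represents (w : List Bool) (B i : ℕ) (T : Fin k → ℕ → Sym) (ρ : Option (Fin k) → ℕ) : Prop :=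
  i + ρ none = w.length + 1 ∧
    ∀ t, ∃ u, T t = tapeOf u ∧ binVal u = ρ (some t) ∧ u.length ≤ B.size

theorem Represents.update {B : ℕ} {ρ : Option (Fin k) → ℕ} (h : Represents w B i T ρ)
    {u : List Bool} (hu : u.length ≤ B.size) :
    Represents w B i (Function.update T r (tapeOf u))
      (Function.update ρ (some r) (binVal u)) := by
  refine ⟨by simpa using h.1, fun t => ?_⟩
  obtain rfl | ht := eq_or_ne t r
  · exact ⟨u, by simp, by simp, hu⟩
  · simpa [ht] using h.2 t

/-- From `l`, the registers `ρ` and the output `out`, the machine of `P` gets in space `s` to `l'`,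
the registers `ρ'` and the output `out'`. -/
def Prog.Leads (P : Prog k) (w : List Bool) (B s : ℕ) (l : List (Prog k))
    (ρ : Option (Fin k) → ℕ) (out : List Bool) (l' : List (Prog k)) (ρ' : Option (Fin k) → ℕ)
    (out' : List Bool) : Prop :=
  ∀ i T, Represents w B i T ρ → ∃ i' T', Represents w B i' T' ρ' ∧
    P.machine.RunIn w s (P.conf l none i T 0 out) (P.conf l' none i' T' 0 out')

variable {B : ℕ} {ρ ρ' ρ'' : Option (Fin k) → ℕ}

theorem Prog.Leads.trans {l'' : List (Prog k)} {out' out'' : List Bool}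
    (h : P.Leads w B s l ρ out l' ρ' out') (h' : P.Leads w B s l' ρ' out' l'' ρ'' out'') :
    P.Leads w B s l ρ out l'' ρ'' out'' := by
  intro i T hT
  obtain ⟨i', T', hT', hrun⟩ := h i T hT
  obtain ⟨i'', T'', hT'', hrun'⟩ := h' i' T' hT'
  exact ⟨i'', T'', hT'', hrun.trans hrun'⟩

theorem leads_of_dispatch (hs : 0 < s) (hl : l ∈ continuations P []) (o : Option Bool)
    (h : ∀ cell syms, dispatch cell syms l = some ((l', none), .stay, idle syms, o)) :
    P.Leads w B s l ρ out l' ρ (out ++ o.toList) := by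
  intro i T hT
  refine ⟨i, T, hT, ?_⟩
  have := runIn_idle (w := w) (i := i) (T := T) (out := out) hs hl (h _ _)
  rwa [Move.apply, min_eq_left (hT.1 ▸ Nat.le_add_right _ _)] at this

theorem runIn_startPhase {u v : List Bool} {b : Bool} {κ : Phase} (hs : 0 < s)
    (hrun : CounterRun s b (tapeOf v) κ (tapeOf u) 1) (hT : T r = tapeOf u)
    (hi : i ≤ w.length + 1) (hl : l ∈ continuations P [])
    (h : ∀ cell syms, dispatch cell syms l = some (startPhase κ r l syms)) :
    P.machine.RunIn w s (P.conf l none i T 0 out)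
      (P.conf (resume b l) none i (Function.update T r (tapeOf v)) 0 out) := by
  have hstart := step_conf_update (P := P) (w := w) (l' := l) (r := r) (T := T) (h := 0)
    (out := out) (ph := none) (ph' := some (κ, r)) (a := (T r 0, .right)) hl hi fun syms hsyms => by
      simp only [transition, h, startPhase, hsyms]
  rw [Function.update_eq_self, Function.update_eq_self, Pi.single_zero] at hstart
  exact .head ⟨fun _ => hs, hstart⟩ (hrun.runIn hT hi hl)

theorem leads_inc (hs : B.size + 1 < s) (hl : .inc r :: l ∈ continuations P [])
    (hB : ρ (some r) + 1 ≤ B) :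
    P.Leads w B s (.inc r :: l) ρ out l (Function.update ρ (some r) (ρ (some r) + 1)) out := by
  intro i T hT
  obtain ⟨u, hu, hval, hlen⟩ := hT.2 r
  have hlen' : (binInc u).length ≤ B.size := by
    obtain h | ⟨h, hpow⟩ := length_binInc u
    · rwa [h]
    · rw [h, Nat.add_one_le_iff, Nat.lt_size]
      omega
  refine ⟨i, Function.update T r (tapeOf (binInc u)), ?_, ?_⟩
  · rw [← hval, ← binVal_binInc]
    exact hT.update hlen'
  · have hrun : CounterRun s true (tapeOf (binInc u)) .up (tapeOf u) 1 :=
      .up [] u (by rw [List.length_nil]; omega)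
    exact runIn_startPhase (by omega) hrun hu (hT.1 ▸ Nat.le_add_right _ _) hl fun _ _ => rfl

theorem inputCell_length_add_one (w : List Bool) : inputCell w (w.length + 1) = .rightEnd := by
  simp [inputCell]

theorem inputCell_ne_rightEnd {a : ℕ} (ha : a ≤ w.length) : inputCell w a ≠ .rightEnd := by
  unfold inputCell
  split_ifs with h0
  · nofun
  · rw [List.getElem?_eq_getElem (by omega)]
    nofun

theorem leads_test_none (hs : 0 < s) (hl : l ∈ continuations P [])
    (h : ∀ cell syms, dispatch cell syms l = some (test l cell syms none)) :
    P.Leads w B s l ρ out (resume (decide (ρ none ≠ 0)) l)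
      (Function.update ρ none (ρ none - 1)) out := by
  intro i T hT
  obtain hρ | hρ := eq_or_ne (ρ none) 0
  · obtain rfl : i = w.length + 1 := by have := hT.1; omega
    have hrun := runIn_idle (w := w) (i := w.length + 1) (T := T) (o := none) (out := out)
      (l' := resume false l) (mv := .stay) hs hl
      (by rw [transition, h, inputCell_length_add_one]; rfl)
    refine ⟨w.length + 1, T, ?_, ?_⟩
    · rwa [Function.update_eq_self_iff.2 (by omega)]
    · simpa [hρ, Move.apply] using hrun
  · have hi : i ≤ w.length := by have := hT.1; omega
    have hrun := runIn_idle (w := w) (i := i) (T := T) (o := none) (out := out)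
      (l' := resume true l) (mv := .right) hs hl (by
        have := inputCell_ne_rightEnd hi
        rw [transition, h]
        revert this
        cases inputCell w i <;> first | exact fun _ => rfl | exact fun h => absurd rfl h)
    refine ⟨i + 1, T, ⟨?_, fun t => ?_⟩, ?_⟩
    · have := hT.1
      rw [Function.update_self]
      omega
    · simpa using hT.2 t
    · simpa [hρ, Move.apply, min_eq_left (Nat.succ_le_succ hi)] using hrun

theorem leads_test (hs : B.size + 1 < s) (hl : l ∈ continuations P []) (r : Option (Fin k))
    (h : ∀ cell syms, dispatch cell syms l = some (test l cell syms r)) :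
    P.Leads w B s l ρ out (resume (decide (ρ r ≠ 0)) l) (Function.update ρ r (ρ r - 1)) out := by
  cases r with
  | none => exact leads_test_none (by omega) hl h
  | some r =>
    intro i T hT
    obtain ⟨u, hu, hval, hlen⟩ := hT.2 r
    obtain ⟨v, hrun, hval', hlen'⟩ := CounterRun.exists_down (s := s) u (by omega)
    rw [← hval, ← hval']
    exact ⟨i, _, hT.update (hlen' ▸ hlen), runIn_startPhase (by omega) hrun hu
      (hT.1 ▸ Nat.le_add_right _ _) hl h⟩

theorem Exec.leads {Q : Prog k} {o : List Bool} (hQ : Exec B Q ρ ρ' o) (hs : B.size + 1 < s)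
    (hc : continuations Q l ⊆ continuations P []) (out : List Bool) :
    P.Leads w B s (Q :: l) ρ out l ρ' (out ++ o) := by
  induction hQ generalizing l out with
  | skip => exact leads_of_dispatch (by omega) (hc (cons_mem_continuations _ _)) none fun _ _ => rfl
  | inc r ρ hB =>
    rw [List.append_nil]
    exact leads_inc hs (hc (cons_mem_continuations _ _)) hB
  | pred r ρ =>
    have := leads_test (w := w) (ρ := ρ) (out := out) hs (hc (cons_mem_continuations _ _)) r
      fun _ _ => rfl
    rw [List.append_nil]
    revert this
    cases decide (ρ r ≠ 0) <;> exact id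
  | emit b =>
    exact leads_of_dispatch (by omega) (hc (cons_mem_continuations _ _)) (some b) fun _ _ => rfl
  | @seq Q Q' ρ _ _ o o' _ _ ihQ ihQ' =>
    have := leads_of_dispatch (w := w) (B := B) (s := s) (ρ := ρ) (out := out) (by omega)
      (hc (cons_mem_continuations _ _)) none fun _ _ => rfl
    rw [Option.toList_none, List.append_nil] at this
    rw [← List.append_assoc]
    exact (this.trans (ihQ (fun _ h => hc (.inl (.inr h))) out)).trans
      (ihQ' (fun _ h => hc (.inr h)) (out ++ o))
  | @loop_zero r _ ρ h0 =>
    have := leads_test (w := w) (ρ := ρ) (out := out) hs (hc (cons_mem_continuations _ _)) r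
      fun _ _ => rfl
    rw [Function.update_eq_self_iff.2 (by omega), decide_eq_false (not_not.2 h0)] at this
    rw [List.append_nil]
    exact this
  | @loop_succ r Q ρ _ _ o o' h0 _ _ ihQ ihloop =>
    have := leads_test (w := w) (ρ := ρ) (out := out) hs (hc (cons_mem_continuations _ _)) r
      fun _ _ => rfl
    rw [decide_eq_true h0] at this
    rw [← List.append_assoc]
    exact (this.trans (ihQ (fun _ h => hc (.inr h)) out)).trans (ihloop hc (out ++ o))

end Simulation

/-- The registers at the start: the input head is to the left of the input `w`. -/
def initial (k : ℕ) (w : List Bool) : Option (Fin k) → ℕ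
  | none => w.length + 1
  | some _ => 0

theorem Exec.computesInSpace {P : Prog k} {B : ℕ} {w o : List Bool} {ρ : Option (Fin k) → ℕ}
    (hP : Exec B P (initial k w) ρ o) : P.machine.ComputesInSpace w o (B.size + 2) := by
  have hinit : Represents w B 0 (fun _ _ => none) (initial k w) :=
    ⟨Nat.zero_add _, fun _ => ⟨[], tapeOf_nil.symm, rfl, Nat.zero_le _⟩⟩
  obtain ⟨i, T, -, hrun⟩ := hP.leads (Nat.lt_succ_self _) subset_rfl [] 0 _ hinit
  have hhalt : P.machine.step w (P.conf [] none i T 0 o) = none := by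
    simp only [Machine.step, Prog.machine, Prog.conf, coe_clip (mem_continuations P [])]
    rfl
  exact ⟨⟨_, hrun.reaches, hhalt, rfl⟩, fun _ => hrun.head_lt (fun _ => Nat.succ_pos _) hhalt⟩

theorem Machine.ComputesInSpace.mono {M : Machine} {w out : List Bool} {s s' : ℕ}
    (h : M.ComputesInSpace w out s) (hs : s ≤ s') : M.ComputesInSpace w out s' :=
  ⟨h.1, fun c hc t => (h.2 c hc t).trans_le hs⟩

end TM

/-! ### Programs that write descriptions of circuits -/

namespace TM

open Circ.TreeScheme (leaves lt_leaves)

section Writing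

variable {k B : ℕ} {P Q : Prog k} {ρ ρ' ρ'' : Option (Fin k) → ℕ}

/-- The program that runs `P` a fixed number of times. -/
def Prog.rep (P : Prog k) : ℕ → Prog k
  | 0 => .skip
  | m + 1 => .seq P (P.rep m)

/-- The program that outputs the unary code of a constant. -/
def emitUnary (m : ℕ) : Prog k := .seq ((Prog.emit true).rep m) (.emit false)

/-- The program that outputs the unary code of `m` plus the content of register `r`, which it saves
in register `t`. -/
def emitSum (t r : Fin k) (m : ℕ) : Prog k :=
  .seq (.loop (some r) (.seq (.emit true) (.inc t)))
    (.seq (.loop (some t) (.inc r)) (emitUnary m))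

theorem Exec.of_eq {o o' : List Bool} (h : Exec B P ρ ρ' o) (hρ : ρ' = ρ'') (ho : o = o') :
    Exec B P ρ ρ'' o' :=
  hρ ▸ ho ▸ h

theorem Exec.seq_silent {o : List Bool} (h : Exec B P ρ ρ' []) (h' : Exec B Q ρ' ρ'' o) :
    Exec B (.seq P Q) ρ ρ'' o :=
  h.seq h'

theorem Exec.loop {r : Option (Fin k)} (m : ℕ) (σ : ℕ → Option (Fin k) → ℕ) (o : ℕ → List Bool)
    (hstart : ρ = σ 0) (hend : σ m = ρ') (hr : ∀ i < m, σ i r ≠ 0) (hzero : σ m r = 0)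
    (hstep : ∀ i < m, Exec B P (Function.update (σ i) r (σ i r - 1)) (σ (i + 1)) (o i)) :
    Exec B (.loop r P) ρ ρ' ((List.range m).flatMap o) := by
  subst hstart hend
  induction m generalizing σ o with
  | zero => exact .loop_zero hzero
  | succ m ih =>
    rw [List.range_succ_eq_map, List.flatMap_cons, List.flatMap_map]
    exact .loop_succ (hr 0 m.succ_pos) (hstep 0 m.succ_pos)
      (ih (fun i => σ (i + 1)) (fun i => o (i + 1)) (fun i hi => hr _ (Nat.succ_lt_succ hi)) hzero
        fun i hi => hstep _ (Nat.succ_lt_succ hi))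

theorem Exec.loop_silent {r : Option (Fin k)} (m : ℕ) (σ : ℕ → Option (Fin k) → ℕ)
    (hstart : ρ = σ 0) (hend : σ m = ρ') (hr : ∀ i < m, σ i r ≠ 0) (hzero : σ m r = 0)
    (hstep : ∀ i < m, Exec B P (Function.update (σ i) r (σ i r - 1)) (σ (i + 1)) []) :
    Exec B (.loop r P) ρ ρ' [] :=
  (Exec.loop m σ (fun _ => []) hstart hend hr hzero hstep).of_eq rfl (by simp)

theorem exec_rep_emit (b : Bool) (m : ℕ) (ρ : Option (Fin k) → ℕ) :
    Exec B ((Prog.emit b).rep m) ρ ρ (List.replicate m b) := by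
  induction m with
  | zero => exact .skip ρ
  | succ m ih => exact (Exec.emit b ρ).seq ih

theorem exec_rep_inc {r : Fin k} {m : ℕ} (h : ρ (some r) + m ≤ B) :
    Exec B ((Prog.inc r).rep m) ρ (Function.update ρ (some r) (ρ (some r) + m)) [] := by
  induction m generalizing ρ with
  | zero => exact (Exec.skip ρ).of_eq (by simp) rfl
  | succ m ih =>
    refine ((Exec.inc r ρ (by omega)).seq_silent (ih ?_)).of_eq ?_ rfl
    · rw [Function.update_self]
      omega
    · rw [Function.update_self, Function.update_idem, Nat.add_assoc, Nat.add_comm 1]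

theorem exec_emitUnary (m : ℕ) (ρ : Option (Fin k) → ℕ) :
    Exec B (emitUnary m) ρ ρ (KSPM.unary m) :=
  (exec_rep_emit true m ρ).seq (.emit false ρ)

theorem exec_emitSum {t r : Fin k} (htr : t ≠ r) (m : ℕ) (ht : ρ (some t) = 0)
    (hB : ρ (some r) ≤ B) : Exec B (emitSum t r m) ρ ρ (KSPM.unary (ρ (some r) + m)) := by
  set a := ρ (some r) with ha
  let σ (i j : ℕ) := Function.update (Function.update ρ (some r) i) (some t) j
  have σ_left (i j : ℕ) : σ i j (some r) = i := by simp [σ, htr.symm]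
  have σ_right (i j : ℕ) : σ i j (some t) = j := by simp [σ]
  have update_left (i j z : ℕ) : Function.update (σ i j) (some r) z = σ z j := by
    simp only [σ]
    rw [Function.update_comm (by simpa using htr), Function.update_idem]
  have update_right (i j z : ℕ) : Function.update (σ i j) (some t) z = σ i z :=
    Function.update_idem _ _ _
  have σ_start : σ a 0 = ρ := by
    simp only [σ, ha, Function.update_eq_self, ← ht]
  have hsave : Exec B (.loop (some r) (.seq (.emit true) (.inc t))) ρ (σ 0 a)
      ((List.range a).flatMap fun _ => [true]) := by
    refine Exec.loop a (fun i => σ (a - i) i) _ σ_start.symm (by rw [Nat.sub_self])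
      (fun i hi => by rw [σ_left]; omega) (by rw [σ_left, Nat.sub_self]) fun i hi => ?_
    rw [σ_left, update_left, ← update_right _ i (i + 1)]
    have := Exec.inc t (σ (a - i - 1) i) (B := B) (by rw [σ_right]; omega)
    rw [σ_right] at this
    exact (Exec.emit true _).seq this
  have hrestore : Exec B (.loop (some t) (.inc r)) (σ 0 a) ρ [] := by
    refine Exec.loop_silent a (fun i => σ i (a - i)) rfl (by rw [Nat.sub_self, σ_start])
      (fun i hi => by rw [σ_right]; omega) (by rw [σ_right, Nat.sub_self]) fun i hi => ?_
    have := Exec.inc r (σ i (a - i - 1)) (B := B) (by rw [σ_left]; omega)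
    rw [σ_left, update_left] at this
    rwa [σ_right, update_right]
  refine (hsave.seq (hrestore.seq_silent (exec_emitUnary m ρ))).of_eq rfl ?_
  rw [← List.map_eq_flatMap, List.map_const', List.length_range, KSPM.unary, KSPM.unary,
    ← List.append_assoc, List.replicate_append_replicate]

end Writing

/-- The program that outputs the description of a gate. The registers `0`, `1` and `2` hold the
arguments of `Circ.TGate.inst`, and register `3` is auxiliary. -/
def emitGate : Circ.TGate → Prog 8
  | .input => .seq (emitUnary 0) (emitSum 3 0 0)
  | .const b => .seq (emitUnary 1) (emitUnary b.toNat)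
  | .not u => .seq (emitUnary 2) (emitSum 3 (bif u.1 then 2 else 1) u.2)
  | .or u v => .seq (.seq (emitUnary 4) (emitSum 3 (bif u.1 then 2 else 1) u.2))
      (emitSum 3 (bif v.1 then 2 else 1) v.2)

/-- The program that outputs the description of a list of gates, with the registers of
`emitGate`. -/
def emitGates : List Circ.TGate → Prog 8
  | [] => .skip
  | g :: T => .seq (emitGate g) (emitGates T)

section Gates

variable {B : ℕ} {ρ : Option (Fin 8) → ℕ}

theorem exec_emitGate (hx : ρ (some 0) ≤ B) (ha : ρ (some 1) ≤ B) (hl : ρ (some 2) ≤ B)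
    (ht : ρ (some 3) = 0) (g : Circ.TGate) :
    Exec B (emitGate g) ρ ρ (g.inst (ρ (some 0)) (ρ (some 1)) (ρ (some 2))).encode := by
  have exec_arg : ∀ u : Bool × ℕ, Exec B (emitSum 3 (bif u.1 then 2 else 1) u.2) ρ ρ
      (KSPM.unary (Circ.TGate.arg (ρ (some 1)) (ρ (some 2)) u))
    | (false, i) => exec_emitSum (r := 1) (by decide) i ht ha
    | (true, i) => exec_emitSum (r := 2) (by decide) i ht hl
  cases g with
  | input => exact (exec_emitUnary _ _).seq (exec_emitSum (by decide) 0 ht hx)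
  | const b => exact (exec_emitUnary _ _).seq (exec_emitUnary _ _)
  | not u => exact (exec_emitUnary _ _).seq (exec_arg u)
  | or u v => exact ((exec_emitUnary _ _).seq (exec_arg u)).seq (exec_arg v)

theorem exec_emitGates (hx : ρ (some 0) ≤ B) (ha : ρ (some 1) ≤ B) (hl : ρ (some 2) ≤ B)
    (ht : ρ (some 3) = 0) (T : List Circ.TGate) :
    Exec B (emitGates T) ρ ρ
      ((T.map (Circ.TGate.inst (ρ (some 0)) (ρ (some 1)) (ρ (some 2)))).flatMap
        Circ.Gate.encode) := by
  induction T with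
  | nil => exact .skip ρ
  | cons g T ih => exact (exec_emitGate hx ha hl ht g).seq ih

end Gates

/-- The registers: `m` counts the remaining cells of the input, `x`, `a`, `l` and the auxiliary `t`
are the registers of `emitGate`, and `d`, `n`, `v` and `c` are counters. -/
def regs (m x a l t d n v c : ℕ) : Option (Fin 8) → ℕ
  | none => m
  | some r => ![x, a, l, t, d, n, v, c] r

section Setup

variable {B m x a l t d n v c : ℕ}

theorem update_regs_none (z : ℕ) :
    Function.update (regs m x a l t d n v c) none z = regs z x a l t d n v c := by
  funext r
  rcases r with _ | r
  · rfl
  · exact Function.update_of_ne (Option.some_ne_none r) _ _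

theorem update_regs_some (r : Fin 8) (z : ℕ) :
    Function.update (regs m x a l t d n v c) (some r) z =
      regs m (if r = 0 then z else x) (if r = 1 then z else a) (if r = 2 then z else l)
        (if r = 3 then z else t) (if r = 4 then z else d) (if r = 5 then z else n)
        (if r = 6 then z else v) (if r = 7 then z else c) := by
  funext i
  rcases i with _ | i
  · rfl
  · fin_cases r <;> fin_cases i <;> rfl

/-- The program that doubles the content `n` of register `5` and replaces the content `d` of
register `4` by `d + 1 - n`. -/
def doubleBody : Prog 8 :=
  .seq (.inc 4) <| .seq
    (.loop (some 5) (.seq (.inc 6) (.seq (.inc 6) (.pred (some 4)))))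
    (.loop (some 6) (.inc 5))

theorem exec_doubleBody (hd : d + 1 ≤ B) (hn : 2 * n ≤ B) :
    Exec B doubleBody (regs m x a l t d n 0 c) (regs m x a l t (d + 1 - n) (2 * n) 0 c) [] := by
  have hcount : Exec B (.loop (some 5) (.seq (.inc 6) (.seq (.inc 6) (.pred (some 4)))))
      (regs m x a l t (d + 1) n 0 c) (regs m x a l t (d + 1 - n) 0 (2 * n) c) [] := by
    refine .loop_silent n (fun i => regs m x a l t (d + 1 - i) (n - i) (2 * i) c) rfl
      (by rw [Nat.sub_self]) (fun i hi => Nat.sub_ne_zero_of_lt hi) (Nat.sub_self _) fun i hi => ?_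
    rw [update_regs_some]
    have hi' : 2 * i + 2 ≤ B := by omega
    refine .seq_silent ((Exec.inc 6 _ (Nat.le_of_lt hi')).of_eq (update_regs_some 6 _) rfl) <|
      .seq_silent ((Exec.inc 6 _ hi').of_eq (update_regs_some 6 _) rfl) <|
      (Exec.pred (some 4) _).of_eq (update_regs_some 4 _) rfl
  have hmove : Exec B (.loop (some 6) (.inc 5)) (regs m x a l t (d + 1 - n) 0 (2 * n) c)
      (regs m x a l t (d + 1 - n) (2 * n) 0 c) [] := by
    refine .loop_silent (2 * n) (fun i => regs m x a l t (d + 1 - n) i (2 * n - i) c) rfl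
      (by rw [Nat.sub_self]) (fun i hi => Nat.sub_ne_zero_of_lt hi) (Nat.sub_self _) fun i hi => ?_
    rw [update_regs_some]
    exact (Exec.inc 5 _ (by exact hi.trans_le hn)).of_eq (update_regs_some 5 _) rfl
  exact .seq_silent ((Exec.inc 4 _ hd).of_eq (update_regs_some 4 _) rfl)
    (hcount.seq_silent hmove)

/-- The program that computes, from the length `n` of the input, `n` in register `7`, `leaves n` in
register `4` and `leaves n - 1` in register `6`. -/
def setup : Prog 8 :=
  .seq (.loop none (.seq (.inc 4) (.inc 7))) <| .seq (.inc 5) <|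
    .seq (.loop (some 4) doubleBody) <| .seq (.loop (some 5) (.seq (.inc 4) (.inc 6))) <|
    .seq (.pred (some 6)) (.pred (some 7))

theorem exec_loop_doubleBody (hB : 2 * leaves n ≤ B) :
    Exec B (.loop (some 4) doubleBody) (regs m x a l t (n + 1) 1 0 c)
      (regs m x a l t 0 (leaves n) 0 c) [] := by
  have hN := lt_leaves n
  -- Run number `i` takes `2 ^ i` from register `4`, hence the first `i` runs take `2 ^ i - 1`.
  refine .loop_silent (n + 1).size (fun i => regs m x a l t (n + 2 - 2 ^ i) (2 ^ i) 0 c) rfl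
    ?_ (fun i hi => ?_) (Nat.sub_eq_zero_of_le hN) fun i hi => ?_
  · rw [Nat.sub_eq_zero_of_le (show n + 2 ≤ 2 ^ (n + 1).size from hN), leaves]
  · exact Nat.sub_ne_zero_of_lt (Nat.lt_succ_of_le (Nat.lt_size.1 hi))
  · have hle := Nat.lt_size.1 hi
    have hpow : 2 ^ (i + 1) ≤ leaves n := Nat.pow_le_pow_right two_pos hi
    rw [update_regs_some]
    rw [pow_succ'] at hpow ⊢
    change Exec B doubleBody (regs m x a l t (n + 2 - 2 ^ i - 1) (2 ^ i) 0 c) _ []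
    rw [show n + 2 - 2 * 2 ^ i = n + 2 - 2 ^ i - 1 + 1 - 2 ^ i by omega]
    exact exec_doubleBody (by omega) (by omega)

theorem exec_setup (hB : 2 * leaves n ≤ B) :
    Exec B setup (regs (n + 1) 0 0 0 0 0 0 0 0)
      (regs 0 0 0 0 0 (leaves n) 0 (leaves n - 1) n) [] := by
  have hN := lt_leaves n
  have hlength : Exec B (.loop none (.seq (.inc 4) (.inc 7))) (regs (n + 1) 0 0 0 0 0 0 0 0)
      (regs 0 0 0 0 0 (n + 1) 0 0 (n + 1)) [] := by
    refine .loop_silent (n + 1) (fun i => regs (n + 1 - i) 0 0 0 0 i 0 0 i) rfl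
      (by rw [Nat.sub_self]) (fun i hi => Nat.sub_ne_zero_of_lt hi) (Nat.sub_self _) fun i hi => ?_
    have hi' : i + 1 ≤ B := by omega
    rw [update_regs_none]
    exact .seq_silent ((Exec.inc 4 _ hi').of_eq (update_regs_some 4 _) rfl)
      ((Exec.inc 7 _ hi').of_eq (update_regs_some 7 _) rfl)
  have hcopy : Exec B (.loop (some 5) (.seq (.inc 4) (.inc 6)))
      (regs 0 0 0 0 0 0 (leaves n) 0 (n + 1))
      (regs 0 0 0 0 0 (leaves n) 0 (leaves n) (n + 1)) [] := by
    refine .loop_silent (leaves n) (fun i => regs 0 0 0 0 0 i (leaves n - i) i (n + 1)) rfl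
      (by rw [Nat.sub_self]) (fun i hi => Nat.sub_ne_zero_of_lt hi) (Nat.sub_self _) fun i hi => ?_
    have hi' : i + 1 ≤ B := by omega
    rw [update_regs_some]
    exact .seq_silent ((Exec.inc 4 _ hi').of_eq (update_regs_some 4 _) rfl)
      ((Exec.inc 6 _ hi').of_eq (update_regs_some 6 _) rfl)
  have hone : 0 + 1 ≤ B := by omega
  exact hlength.seq_silent <|
    .seq_silent ((Exec.inc 5 _ hone).of_eq (update_regs_some 5 _) rfl) <|
    (exec_loop_doubleBody hB).seq_silent <| hcopy.seq_silent <|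
    .seq_silent ((Exec.pred (some 6) _).of_eq (update_regs_some 6 _) rfl)
      ((Exec.pred (some 7) _).of_eq (update_regs_some 7 _) rfl)

end Setup

/-- The program that outputs the gates of a block and moves on to the next one, whose children are
`step` gates further. -/
def emitBlock (S : Circ.TreeScheme) (T : List Circ.TGate) (step : ℕ) : Prog 8 :=
  .seq (emitGates T) <| .seq (.inc 0) <| .seq ((Prog.inc 1).rep S.blk) ((Prog.inc 2).rep step)

/-- The program that outputs the description of the circuit of `S`, from the length of the input. -/
def emitCircuit (S : Circ.TreeScheme) : Prog 8 :=
  .seq setup <|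
  .seq (.loop (some 7) (.seq (.pred (some 4)) (emitBlock S S.leafT 0))) <|
  .seq (.loop (some 4) (emitBlock S S.unitT 0)) <|
  .seq (.loop (some 6) (emitBlock S S.nodeT (2 * S.blk))) <|
  emitGates S.outT

/-- The registers before block number `j` of the circuit for inputs of length `n`. -/
abbrev atBlock (S : Circ.TreeScheme) (n j d v c : ℕ) : Option (Fin 8) → ℕ :=
  regs 0 j (S.blk * j) (S.blk * (2 * (j - leaves n))) 0 d 0 v c

section Circuit

variable {S : Circ.TreeScheme} {B n j d v c : ℕ}

theorem blk_mul_le (hB : (S.blk + 1) * (2 * leaves n) ≤ B) (hj : j ≤ 2 * leaves n) :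
    S.blk * j + 2 * leaves n ≤ B :=
  calc S.blk * j + 2 * leaves n
    _ ≤ S.blk * (2 * leaves n) + 2 * leaves n := Nat.add_le_add_right (Nat.mul_le_mul_left _ hj) _
    _ = (S.blk + 1) * (2 * leaves n) := (Nat.succ_mul _ _).symm
    _ ≤ B := hB

theorem exec_emitGates_atBlock (hB : (S.blk + 1) * (2 * leaves n) ≤ B) (hj : j < 2 * leaves n)
    (T : List Circ.TGate) :
    Exec B (emitGates T) (atBlock S n j d v c) (atBlock S n j d v c)
      ((S.place n j T).flatMap Circ.Gate.encode) := by
  have hfirst := blk_mul_le hB hj.le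
  have hchild := blk_mul_le hB (show 2 * (j - leaves n) ≤ 2 * leaves n by omega)
  exact exec_emitGates (show j ≤ B by omega) (show S.blk * j ≤ B by omega)
    (show S.blk * (2 * (j - leaves n)) ≤ B by omega) rfl T

theorem exec_emitBlock (hB : (S.blk + 1) * (2 * leaves n) ≤ B) (hj : j + 1 < 2 * leaves n)
    {step : ℕ} (hstep : S.blk * (2 * (j + 1 - leaves n)) = S.blk * (2 * (j - leaves n)) + step)
    (T : List Circ.TGate) :
    Exec B (emitBlock S T step) (atBlock S n j d v c) (atBlock S n (j + 1) d v c)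
      ((S.place n j T).flatMap Circ.Gate.encode) := by
  have hfirst := blk_mul_le hB hj.le
  have hchild := blk_mul_le hB (show 2 * (j + 1 - leaves n) ≤ 2 * leaves n by omega)
  rw [Nat.mul_succ] at hfirst
  rw [hstep] at hchild
  have hj' : j + 1 ≤ B := by omega
  have hfirst' : S.blk * j + S.blk ≤ B := by omega
  have hchild' : S.blk * (2 * (j - leaves n)) + step ≤ B := by omega
  rw [atBlock, atBlock, hstep, Nat.mul_succ]
  exact ((exec_emitGates_atBlock hB (by omega) T).seq <|
    .seq_silent ((Exec.inc 0 _ hj').of_eq (update_regs_some 0 _) rfl) <|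
    .seq_silent ((exec_rep_inc hfirst').of_eq (update_regs_some 1 _) rfl)
      ((exec_rep_inc hchild').of_eq (update_regs_some 2 _) rfl)).of_eq rfl (List.append_nil _)

theorem exec_loop_leafT (hB : (S.blk + 1) * (2 * leaves n) ≤ B) :
    Exec B (.loop (some 7) (.seq (.pred (some 4)) (emitBlock S S.leafT 0)))
      (atBlock S n 0 (leaves n) v n) (atBlock S n n (leaves n - n) v 0)
      ((List.range n).flatMap fun j =>
        (S.place n j (S.template n j)).flatMap Circ.Gate.encode) := by
  have hN := lt_leaves n
  refine .loop n (fun j => atBlock S n j (leaves n - j) v (n - j)) _ rfl (by rw [Nat.sub_self])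
    (fun j hj => Nat.sub_ne_zero_of_lt hj) (Nat.sub_self _) fun j hj => ?_
  rw [update_regs_some, Circ.TreeScheme.template, if_pos hj]
  have hj' : j + 1 < 2 * leaves n := by omega
  have hstep : S.blk * (2 * (j + 1 - leaves n)) = S.blk * (2 * (j - leaves n)) + 0 := by
    rw [Nat.sub_eq_zero_of_le (by omega), Nat.sub_eq_zero_of_le (by omega), Nat.add_zero]
  exact .seq_silent ((Exec.pred (some 4) _).of_eq (update_regs_some 4 _) rfl)
    (exec_emitBlock hB hj' hstep S.leafT)

theorem exec_loop_unitT (hB : (S.blk + 1) * (2 * leaves n) ≤ B) :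
    Exec B (.loop (some 4) (emitBlock S S.unitT 0))
      (atBlock S n n (leaves n - n) v 0) (atBlock S n (leaves n) 0 v 0)
      ((List.range (leaves n - n)).flatMap fun i =>
        (S.place n (n + i) (S.template n (n + i))).flatMap Circ.Gate.encode) := by
  have hN := lt_leaves n
  refine .loop (leaves n - n) (fun i => atBlock S n (n + i) (leaves n - n - i) v 0) _ rfl
    (by rw [Nat.sub_self, Nat.add_sub_cancel' (by omega)])
    (fun i hi => Nat.sub_ne_zero_of_lt hi) (Nat.sub_self _) fun i hi => ?_
  rw [Circ.TreeScheme.template, if_neg (by omega), if_pos (by omega), update_regs_some]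
  have hj : n + i + 1 < 2 * leaves n := by omega
  have hstep : S.blk * (2 * (n + i + 1 - leaves n)) = S.blk * (2 * (n + i - leaves n)) + 0 := by
    rw [Nat.sub_eq_zero_of_le (by omega), Nat.sub_eq_zero_of_le (by omega), Nat.add_zero]
  exact exec_emitBlock hB hj hstep S.unitT

theorem exec_loop_nodeT (hB : (S.blk + 1) * (2 * leaves n) ≤ B) :
    Exec B (.loop (some 6) (emitBlock S S.nodeT (2 * S.blk)))
      (atBlock S n (leaves n) 0 (leaves n - 1) 0) (atBlock S n (2 * leaves n - 1) 0 0 0)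
      ((List.range (leaves n - 1)).flatMap fun i =>
        (S.place n (leaves n + i) (S.template n (leaves n + i))).flatMap Circ.Gate.encode) := by
  have hN := lt_leaves n
  refine .loop (leaves n - 1) (fun i => atBlock S n (leaves n + i) 0 (leaves n - 1 - i) 0) _ rfl
    (by rw [Nat.sub_self, ← Nat.add_sub_assoc (by omega), ← two_mul])
    (fun i hi => Nat.sub_ne_zero_of_lt hi) (Nat.sub_self _) fun i hi => ?_
  rw [Circ.TreeScheme.template, if_neg (by omega), if_neg (by omega), update_regs_some]
  have hj : leaves n + i + 1 < 2 * leaves n := by omega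
  have hstep : S.blk * (2 * (leaves n + i + 1 - leaves n)) =
      S.blk * (2 * (leaves n + i - leaves n)) + 2 * S.blk := by
    rw [Nat.add_assoc, Nat.add_sub_cancel_left, Nat.add_sub_cancel_left]
    ring
  exact exec_emitBlock hB hj hstep S.nodeT

theorem exec_emitCircuit (hB : (S.blk + 1) * (2 * leaves n) ≤ B) :
    Exec B (emitCircuit S) (regs (n + 1) 0 0 0 0 0 0 0 0) (atBlock S n (2 * leaves n - 1) 0 0 0)
      (Circ.Circuit.encode (S.circuit n)) := by
  have hN := lt_leaves n
  have hstart : regs 0 0 0 0 0 (leaves n) 0 (leaves n - 1) n =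
      atBlock S n 0 (leaves n) (leaves n - 1) n := by
    simp [atBlock]
  have hsetup : 2 * leaves n ≤ B := (Nat.le_add_left _ _).trans (blk_mul_le hB le_rfl)
  have hexec := (hstart ▸ exec_setup hsetup).seq_silent <| (exec_loop_leafT hB).seq <|
    (exec_loop_unitT hB).seq <| (exec_loop_nodeT hB).seq <|
    exec_emitGates_atBlock hB (by omega) S.outT
  refine hexec.of_eq rfl ?_
  have hrange : List.range (2 * leaves n - 1) = List.range n ++
      (List.range (leaves n - n)).map (n + ·) ++
        (List.range (leaves n - 1)).map (leaves n + ·) := by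
    rw [← List.range_add, Nat.add_sub_cancel' (by omega), ← List.range_add,
      ← Nat.add_sub_assoc (by omega), ← two_mul]
  simp only [Circ.Circuit.encode, Circ.TreeScheme.circuit, hrange, List.flatMap_append,
    List.flatMap_map, List.flatMap_assoc, List.append_assoc]

end Circuit

end TM

/-! ### Regular languages -/

theorem size_succ_le_log (n : ℕ) : (n + 1).size ≤ Nat.log 2 n + 2 := by
  rw [Nat.size_le]
  calc n + 1
    _ ≤ 2 ^ (Nat.log 2 n + 1) := Nat.lt_pow_succ_log_self one_lt_two n
    _ < 2 ^ (Nat.log 2 n + 2) := Nat.pow_lt_pow_right one_lt_two (Nat.lt_succ_self _)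

theorem mul_add_le_pow_add (a n : ℕ) : a * n + a ≤ n ^ (2 * a + 1) + (2 * a + 1) := by
  rcases Nat.lt_or_ge n 2 with hn | hn
  · have : a * n ≤ a * 1 := Nat.mul_le_mul_left a (Nat.le_of_lt_succ hn)
    omega
  · have hpow : 2 * a ≤ n ^ (2 * a) :=
      Nat.lt_two_pow_self.le.trans (Nat.pow_le_pow_left hn (2 * a))
    have hmul : a * 1 ≤ a * n := Nat.mul_le_mul_left a (one_le_two.trans hn)
    calc a * n + a
      _ ≤ 2 * a * n := by linarith
      _ ≤ n ^ (2 * a) * n := Nat.mul_le_mul_right n hpow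
      _ = n ^ (2 * a + 1) := (pow_succ n _).symm
      _ ≤ n ^ (2 * a + 1) + (2 * a + 1) := Nat.le_add_right _ _

namespace Circ.TreeScheme

theorem leaves_le (n : ℕ) : leaves n ≤ 2 * (n + 1) := by
  obtain ⟨s, hs⟩ : ∃ s, (n + 1).size = s + 1 :=
    Nat.exists_eq_add_one.2 (Nat.size_pos.2 n.succ_pos)
  have hpow : 2 ^ s ≤ n + 1 := Nat.lt_size.1 (hs ▸ s.lt_succ_self)
  rw [leaves, hs, pow_succ']
  exact Nat.mul_le_mul_left 2 hpow

theorem length_circuit_le (S : TreeScheme) :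
    ∃ a, ∀ n, (S.circuit n).length ≤ n ^ a + a := by
  refine ⟨2 * (4 * S.blk + S.out.size) + 1, fun n => ?_⟩
  refine le_trans ?_ (mul_add_le_pow_add _ n)
  have hN := leaves_le n
  calc (S.circuit n).length
    _ = S.blk * (2 * leaves n - 1) + S.out.size := length_circuit
    _ ≤ S.blk * (4 * (n + 1)) + S.out.size * (n + 1) :=
      Nat.add_le_add (Nat.mul_le_mul_left _ (by omega)) (Nat.le_mul_of_pos_right _ n.succ_pos)
    _ = (4 * S.blk + S.out.size) * n + (4 * S.blk + S.out.size) := by ring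

theorem depth_circuit_le_log (S : TreeScheme) :
    ∃ a, ∀ n, (S.circuit n).depth ≤ a * Nat.log 2 n + a := by
  refine ⟨3 * S.blk + S.out.size, fun n => ?_⟩
  have hsize := size_succ_le_log n
  calc (S.circuit n).depth
    _ ≤ S.blk * ((n + 1).size + 1) + S.out.size := depth_circuit_le S n
    _ ≤ S.blk * (Nat.log 2 n + 3) + S.out.size :=
      Nat.add_le_add_right (Nat.mul_le_mul_left _ (by omega)) _
    _ = S.blk * Nat.log 2 n + (3 * S.blk + S.out.size) := by ring
    _ ≤ (3 * S.blk + S.out.size) * Nat.log 2 n + (3 * S.blk + S.out.size) :=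
      Nat.add_le_add_right (Nat.mul_le_mul_right _ (by omega)) _

theorem size_blk_mul_leaves_le (S : TreeScheme) (n : ℕ) :
    ((S.blk + 1) * (2 * leaves n)).size ≤ S.blk + (Nat.log 2 n + 4) := by
  have hblk : S.blk + 1 ≤ 2 ^ S.blk := Nat.lt_two_pow_self
  have hleaves : 2 * leaves n < 2 ^ (Nat.log 2 n + 4) := by
    rw [leaves, ← pow_succ']
    exact Nat.pow_lt_pow_right one_lt_two (by have := size_succ_le_log n; omega)
  rw [Nat.size_le, pow_add]
  exact Nat.mul_lt_mul_of_le_of_lt hblk hleaves (by positivity)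

theorem logspaceUniform_circuit (S : TreeScheme) : LogspaceUniform S.circuit := by
  refine ⟨(TM.emitCircuit S).machine, S.blk + 6, fun n => ?_⟩
  have hinitial :
      TM.initial 8 (List.replicate n true) = TM.regs (n + 1) 0 0 0 0 0 0 0 0 := by
    funext r
    rcases r with _ | r
    · exact congrArg (· + 1) List.length_replicate
    · fin_cases r <;> rfl
  have hexec := TM.exec_emitCircuit (S := S) (n := n) le_rfl
  refine TM.Machine.ComputesInSpace.mono
    (TM.Exec.computesInSpace (w := List.replicate n true) (hinitial ▸ hexec)) ?_
  calc ((S.blk + 1) * (2 * leaves n)).size + 2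
    _ ≤ Nat.log 2 n + (S.blk + 6) := by have := size_blk_mul_leaves_le S n; omega
    _ ≤ (S.blk + 6) * Nat.log 2 n + (S.blk + 6) :=
      Nat.add_le_add_right (Nat.le_mul_of_pos_left _ (by omega)) _

end Circ.TreeScheme

theorem inNC1_of_prod_mem {M : Type*} [Monoid M] [Finite M] {φ : Bool → M} {A : Set M}
    {L : Language Bool} (hL : ∀ w : List Bool, w ∈ L ↔ (w.map φ).prod ∈ A) : InNC1 L := by
  obtain ⟨S, enc, hS⟩ := Circ.TreeScheme.exists_computes φ A
  exact ⟨S.circuit, S.circuit_wellFormed, fun w => (hL w).trans (hS.eval_circuit w).symm,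
    S.length_circuit_le, S.depth_circuit_le_log, S.logspaceUniform_circuit⟩

/-- The transformation of the states of `M` given by reading `b`, as an element of the transition
monoid of `M`; its product is opposite to the composition, since words are read from the left. -/
def letterAction {α σ : Type*} (M : DFA α σ) (b : α) : (Function.End σ)ᵐᵒᵖ :=
  MulOpposite.op fun s => M.step s b

theorem unop_prod_map_letterAction {α σ : Type*} (M : DFA α σ) (w : List α) (s : σ) :
    (w.map (letterAction M)).prod.unop s = M.evalFrom s w := by
  induction w generalizing s with
  | nil => rfl
  | cons b _ ih => exact ih (M.step s b)

theorem inNC1_of_isRegular {L : Language Bool} (hL : L.IsRegular) : InNC1 L := by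
  obtain ⟨σ, _, M, rfl⟩ := hL
  have : Finite (Function.End σ)ᵐᵒᵖ :=
    have : Finite (Function.End σ) := inferInstanceAs (Finite (σ → σ))
    Finite.of_equiv _ MulOpposite.opEquiv
  exact inNC1_of_prod_mem (φ := letterAction M) (A := {a | a.unop M.start ∈ M.accept}) fun w =>
    iff_of_eq (congrArg (· ∈ M.accept) (unop_prod_map_letterAction M w M.start).symm)

theorem theorem1 (p : ℕ) (hp : 1 < p) : InNC1 (KSPM.AP p) :=
  inNC1_of_isRegular (KSPM.isRegular_AP hp)
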